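/- **Setting.** Let $(X_i,A_i,Y_i(0),Y_i(1))$, $i\ge 1$, be i.i.d. draws from a population $\mathbb P$, with covariates $X$ in a standard Borel space $\mathcal X$ (for instance a Borel subset of $\mathbb R^d$), binary treatment $A\in\{0,1\}$ and real potential outcomes $Y(0),Y(1)$. The observed data are $Z_i=(A_i,X_i,Y_i)$ with $Y_i=A_iY_i(1)+(1-A_i)Y_i(0)$. Assume strong ignorability: $(Y(0),Y(1))\perp A\mid X$, and the propensity score $e(X)=\mathbb P(A=1\mid X)$ satisfies $0<e(X)<1$ almost surely. Let $\tau(X)=\mathbb E[Y(1)-Y(0)\mid X]$. Let $\hat\tau_1,\hat\tau_2:\mathcal X\to\mathbb R$ be two fixed measurable functions (estimators of $\tau$ trained on an independent sample), with relative error $$\delta(\hat\tau_1,\hat\tau_2)=\mathbb E[(\hat\tau_1(X)-\tau(X))^2]-\mathbb E[(\hat\tau_2(X)-\tau(X))^2].$$ Put $$\varphi(Z;\mu_0,\mu_1,e)=\hat\tau_1^2(X)-\hat\tau_2^2(X)-2(\hat\tau_1(X)-\hat\tau_2(X))\Big(\frac{A(Y-\mu_1(X))}{e(X)}+\mu_1(X)-\frac{(1-A)(Y-\mu_0(X))}{1-e(X)}-\mu_0(X)\Big).$$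 Let $\Phi:\mathcal X\to\mathbb R^m$ be a fixed measurable representation, and consider the working models $e(\Phi(x),\gamma)=\exp(\Phi(x)^\top\gamma)/(1+\exp(\Phi(x)^\top\gamma))$ and $\mu_a(\Phi(x),\beta_a)=\Phi(x)^\top\beta_a$, $a=0,1$. Let $\check\gamma,\check\beta_0,\check\beta_1$ (depending on $n$) be arbitrary random vectors in $\mathbb R^m$, let $\bar\gamma,\bar\beta_0,\bar\beta_1\in\mathbb R^m$, and write $\check e=e(\Phi(\cdot),\check\gamma)$, $\check\mu_a=\mu_a(\Phi(\cdot),\check\beta_a)$, $\bar e=e(\Phi(\cdot),\bar\gamma)$, $\bar\mu_a=\mu_a(\Phi(\cdot),\bar\beta_a)$. Define $$\check\delta=\frac1n\sum_{i=1}^n\varphi(Z_i;\check\mu_0,\check\mu_1,\check e),\qquad \hat\sigma^2=\frac1n\sum_{i=1}^n\{\varphi(Z_i;\check\mu_0,\check\mu_1,\check e)-\check\delta\}^2,\qquad \sigma^2=\mathrm{Var}\{\varphi(Z;\bar\mu_0,\bar\mu_1,\bar e)\}.$$ **Conditions.** 1. $\check\gamma-\bar\gamma$, $\check\beta_0-\bar\beta_0$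 and $\check\beta_1-\bar\beta_1$ are $o_{\mathbb P}(n^{-1/4})$. 2. The propensity score model is correctly specified: $e(X)=\bar e(X)$ almost surely. (The outcome models may be misspecified.) 3. $(\bar\beta_0,\bar\beta_1)$ is a stationary point (for instance a minimizer) of the population weighted least squares risk $$(\beta_0,\beta_1)\mapsto\mathbb E\Big[(\hat\tau_1(X)-\hat\tau_2(X))\Big\{\frac{(1-A)\bar e(X)(Y-\Phi(X)^\top\beta_0)^2}{1-\bar e(X)}+\frac{A(1-\bar e(X))(Y-\Phi(X)^\top\beta_1)^2}{\bar e(X)}\Big\}\Big].$$ 4. Moment conditions: $Y(0)$, $Y(1)$, $\hat\tau_1(X)$, $\hat\tau_2(X)$ and $\hat\tau_1^2(X)-\hat\tau_2^2(X)$ are square integrable, and for some $r>0$ $$\mathbb E\Big[(\hat\tau_1(X)-\hat\tau_2(X))^2(1+Y^2)\Big(\frac{A}{\bar e(X)}+\frac{1-A}{1-\bar e(X)}\Big)^2e^{r\|\Phi(X)\|}\Big]<\infty .$$ (For bounded $\Phi$ and bounded $\hat\tau_1,\hat\tau_2$ this only says that $Y(0)$ and $Y(1)$ are square integrable.) **Proposition.**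 Under these conditions, $\hat\sigma^2$ is a consistent estimator of $\sigma^2$: $\hat\sigma^2\to\sigma^2$ in probability as $n\to\infty$. If moreover $\sigma^2>0$, then for every $\eta\in(0,1)$ the interval $\check\delta\pm z_{\eta/2}\sqrt{\hat\sigma^2/n}$, where $z_{\eta/2}$ is the $(1-\eta/2)$ quantile of the standard normal distribution, is an asymptotic $(1-\eta)$ confidence interval for $\delta(\hat\tau_1,\hat\tau_2)$: $$\mathbb P\Big(\check\delta-z_{\eta/2}\sqrt{\hat\sigma^2/n}\le\delta(\hat\tau_1,\hat\tau_2)\le\check\delta+z_{\eta/2}\sqrt{\hat\sigma^2/n}\Big)\to1-\eta .$$ -/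

import Mathlib

open MeasureTheory ProbabilityTheory Filter Topology

noncomputable section

namespace RelErr

/-- Full data of one individual: covariates, treatment, and the potential outcomes
`Y(0)`, `Y(1)`.  Only `(A, X, Y)` with `Y = A Y(1) + (1 - A) Y(0)` is observed. -/
abbrev Indiv (𝒳 : Type*) := 𝒳 × Bool × ℝ × ℝ

/-- Parameter space of the linear heads on an `m`-dimensional representation. -/
abbrev Param (m : ℕ) := EuclideanSpace ℝ (Fin m)

section Data

variable {𝒳 : Type*}

/-- The covariates `X`. -/
def covar (w : Indiv 𝒳) : 𝒳 := w.1

/-- The treatment indicator `A`. -/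
def treat (w : Indiv 𝒳) : Bool := w.2.1

/-- The potential outcome under control, `Y(0)`. -/
def pot0 (w : Indiv 𝒳) : ℝ := w.2.2.1

/-- The potential outcome under treatment, `Y(1)`. -/
def pot1 (w : Indiv 𝒳) : ℝ := w.2.2.2

/-- The treatment as a real number, `0` or `1`. -/
def ind (a : Bool) : ℝ := if a then 1 else 0

/-- The observed data `Z = (A, X, Y)`, where `Y = A Y(1) + (1 - A) Y(0)`. -/
def obs (w : Indiv 𝒳) : Bool × 𝒳 × ℝ :=
  (treat w, covar w, ind (treat w) * pot1 w + (1 - ind (treat w)) * pot0 w)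

variable [MeasurableSpace 𝒳]

theorem measurable_covar : Measurable (covar : Indiv 𝒳 → 𝒳) := measurable_fst

/-- The σ-algebra generated by the covariates. -/
abbrev sigmaX (𝒳 : Type*) [MeasurableSpace 𝒳] : MeasurableSpace (Indiv 𝒳) :=
  MeasurableSpace.comap covar inferInstance

theorem sigmaX_le : sigmaX 𝒳 ≤ (inferInstance : MeasurableSpace (Indiv 𝒳)) :=
  measurable_covar.comap_le

/-- The propensity score `e(X) = P(A = 1 | X)`. -/
def propensity (Q : Measure (Indiv 𝒳)) : Indiv 𝒳 → ℝ :=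
  Q[fun w => ind (treat w) | sigmaX 𝒳]

/-- The conditional average treatment effect `τ(X) = E[Y(1) - Y(0) | X]`. -/
def cate (Q : Measure (Indiv 𝒳)) : Indiv 𝒳 → ℝ :=
  Q[fun w => pot1 w - pot0 w | sigmaX 𝒳]

/-- Strong ignorability: `(Y(0), Y(1))` and `A` are conditionally independent given `X`,
and the propensity score lies strictly between `0` and `1`. -/
def StronglyIgnorable [StandardBorelSpace 𝒳] (Q : Measure (Indiv 𝒳))
    [IsProbabilityMeasure Q] : Prop :=
  CondIndepFun (sigmaX 𝒳) sigmaX_le (fun w : Indiv 𝒳 => (pot0 w, pot1 w)) treat Q ∧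
    ∀ᵐ w ∂Q, 0 < propensity Q w ∧ propensity Q w < 1

/-- The absolute error `φ(τ̂) = E[(τ̂(X) - τ(X))²]`. -/
def absErr (Q : Measure (Indiv 𝒳)) (t : 𝒳 → ℝ) : ℝ :=
  ∫ w, (t (covar w) - cate Q w) ^ 2 ∂Q

/-- The relative error `δ(τ̂₁, τ̂₂) = φ(τ̂₁) - φ(τ̂₂)`. -/
def relErr (Q : Measure (Indiv 𝒳)) (t₁ t₂ : 𝒳 → ℝ) : ℝ :=
  absErr Q t₁ - absErr Q t₂

end Data

section Estimator

variable {𝒳 : Type*} {m : ℕ}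

/-- The summand `φ(z; μ₀, μ₁, e)` of the relative error estimator, at `z = (a, x, y)`. -/
def phi (t₁ t₂ μ₀ μ₁ e : 𝒳 → ℝ) (z : Bool × 𝒳 × ℝ) : ℝ :=
  let a := ind z.1
  let x := z.2.1
  let y := z.2.2
  (t₁ x ^ 2 - t₂ x ^ 2) -
    2 * (t₁ x - t₂ x) *
      (a * (y - μ₁ x) / e x + μ₁ x - (1 - a) * (y - μ₀ x) / (1 - e x) - μ₀ x)

/-- The logistic working model `e(Φ(x), γ)` for the propensity score. -/
def psModel (Φ : 𝒳 → Param m) (γ : Param m) (x : 𝒳) : ℝ :=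
  Real.exp (inner ℝ (Φ x) γ) / (1 + Real.exp (inner ℝ (Φ x) γ))

/-- The linear working model `μ_a(Φ(x), β_a)` for the outcome regressions. -/
def orModel (Φ : 𝒳 → Param m) (β : Param m) (x : 𝒳) : ℝ :=
  inner ℝ (Φ x) β

/-- `φ(z; μ₀(Φ, β₀), μ₁(Φ, β₁), e(Φ, γ))`. -/
def phiModel (t₁ t₂ : 𝒳 → ℝ) (Φ : 𝒳 → Param m) (γ β₀ β₁ : Param m) :
    Bool × 𝒳 × ℝ → ℝ :=
  phi t₁ t₂ (orModel Φ β₀) (orModel Φ β₁) (psModel Φ γ)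

/-- The estimator `δ̌` computed from the first `n` members of the sample `s`. -/
def deltaHat (t₁ t₂ : 𝒳 → ℝ) (Φ : 𝒳 → Param m) (γ β₀ β₁ : Param m)
    (n : ℕ) (s : ℕ → Indiv 𝒳) : ℝ :=
  (1 / (n : ℝ)) * ∑ i ∈ Finset.range n, phiModel t₁ t₂ Φ γ β₀ β₁ (obs (s i))

/-- The variance estimator `σ̂²` computed from the first `n` members of the sample `s`. -/
def sigmaHatSq (t₁ t₂ : 𝒳 → ℝ) (Φ : 𝒳 → Param m) (γ β₀ β₁ : Param m)
    (n : ℕ) (s : ℕ → Indiv 𝒳) : ℝ :=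
  (1 / (n : ℝ)) * ∑ i ∈ Finset.range n,
    (phiModel t₁ t₂ Φ γ β₀ β₁ (obs (s i)) - deltaHat t₁ t₂ Φ γ β₀ β₁ n s) ^ 2

/-- The weighted least squares loss of one observation `z = (a, x, y)`. -/
def wlsLoss (t₁ t₂ : 𝒳 → ℝ) (Φ : 𝒳 → Param m) (γ β₀ β₁ : Param m)
    (z : Bool × 𝒳 × ℝ) : ℝ :=
  let a := ind z.1
  let x := z.2.1
  let y := z.2.2
  let e := psModel Φ γ x
  (t₁ x - t₂ x) *
    ((1 - a) * e * (y - inner ℝ (Φ x) β₀) ^ 2 / (1 - e) +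
      a * (1 - e) * (y - inner ℝ (Φ x) β₁) ^ 2 / e)

/-- The inverse probability weight `a / e(x) + (1 - a) / (1 - e(x))`. -/
def ipw (e : 𝒳 → ℝ) (z : Bool × 𝒳 × ℝ) : ℝ :=
  ind z.1 / e z.2.1 + (1 - ind z.1) / (1 - e z.2.1)

variable [MeasurableSpace 𝒳]

/-- The population risk `E[L_wls(β₀, β₁; γ)]`. -/
def wlsRisk (Q : Measure (Indiv 𝒳)) (t₁ t₂ : 𝒳 → ℝ) (Φ : 𝒳 → Param m)
    (γ β₀ β₁ : Param m) : ℝ :=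
  ∫ w, wlsLoss t₁ t₂ Φ γ β₀ β₁ (obs w) ∂Q

/-- `(β₀, β₁)` is a stationary point of the population weighted least squares risk
(in particular: a minimizer, whenever one exists; the weight `t₁ - t₂` may change sign). -/
def IsWLSStationary (Q : Measure (Indiv 𝒳)) (t₁ t₂ : 𝒳 → ℝ) (Φ : 𝒳 → Param m)
    (γ β₀ β₁ : Param m) : Prop :=
  HasFDerivAt (fun b : Param m × Param m => wlsRisk Q t₁ t₂ Φ γ b.1 b.2)
    (0 : Param m × Param m →L[ℝ] ℝ) (β₀, β₁)

/-- Moment conditions: the potential outcomes, the two CATE estimators and the difference of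
their squares are square integrable, and the inverse probability weighted second moment of
`(τ̂₁ - τ̂₂) (1, Y)` is finite with a small exponential tilt in `‖Φ(X)‖`. -/
structure MomentConditions (Q : Measure (Indiv 𝒳)) (t₁ t₂ : 𝒳 → ℝ) (Φ : 𝒳 → Param m)
    (γ : Param m) : Prop where
  pot0_sq : MemLp (fun w : Indiv 𝒳 => pot0 w) 2 Q
  pot1_sq : MemLp (fun w : Indiv 𝒳 => pot1 w) 2 Q
  est1_sq : MemLp (fun w : Indiv 𝒳 => t₁ (covar w)) 2 Q
  est2_sq : MemLp (fun w : Indiv 𝒳 => t₂ (covar w)) 2 Q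
  diff_sq : MemLp (fun w : Indiv 𝒳 => t₁ (covar w) ^ 2 - t₂ (covar w) ^ 2) 2 Q
  weighted : ∃ r : ℝ, 0 < r ∧ Integrable (fun w : Indiv 𝒳 =>
    (t₁ (covar w) - t₂ (covar w)) ^ 2 * (1 + (obs w).2.2 ^ 2) *
      ipw (psModel Φ γ) (obs w) ^ 2 * Real.exp (r * ‖Φ (covar w)‖)) Q

/-- The asymptotic variance `σ² = Var φ(Z; μ̄₀, μ̄₁, ē)`. -/
def sigmaSq (Q : Measure (Indiv 𝒳)) (t₁ t₂ : 𝒳 → ℝ) (Φ : 𝒳 → Param m)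
    (γ β₀ β₁ : Param m) : ℝ :=
  variance (fun w => phiModel t₁ t₂ Φ γ β₀ β₁ (obs w)) Q

end Estimator

/-- `θ̂ n = θ + o_P(n^{-1/4})`: convergence in probability at a rate faster than `n^{-1/4}`. -/
def FasterThanQuarter {Ω : Type*} [MeasurableSpace Ω] {m : ℕ} (P : Measure Ω)
    (θhat : ℕ → Ω → Param m) (θ : Param m) : Prop :=
  TendstoInMeasure P (fun (n : ℕ) ω => ((n : ℝ) ^ (1 / 4 : ℝ)) • (θhat n ω - θ)) atTop
    (fun _ => (0 : Param m))

/-- The quantile function of the standard normal distribution. -/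
def normalQuantile (p : ℝ) : ℝ :=
  sInf {t : ℝ | p ≤ cdf (gaussianReal 0 1) t}

end RelErr

end

/-! Put θ = (γ, β₀, β₁) and regard the score φ as a function of θ. Two facts about its mean at the
limit θ̄ drive the result. First, φ is unbiased for the relative error there: with a correct
propensity score, inverse weighting recovers the integrals of (τ̂₁ - τ̂₂) Y(a), and the outcome
models cancel (`integral_phiModel`). Second, the gradient of φ in θ has mean zero. In β₀ and β₁ this
holds because the inverse probability weights have conditional mean one (`integral_orCoef₀`,
`integral_orCoef₁`). In γ it is the normal equation of the weighted least squares problem: the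
weights e/(1-e) and (1-e)/e are exactly the factors produced by differentiating 1/(1-e) and 1/e for
the logistic model (`integral_psCoef`).

Plugging in θ̌ therefore has no first order effect. A pointwise Taylor expansion
(`exists_phiModel_expansion`) bounds √n times the difference of the two averages of φ by the product
of n^{-3/4} Σ ∇φ and n^{1/4} ‖θ̌ - θ̄‖, plus a constant times (n^{1/4} ‖θ̌ - θ̄‖)² times the average
of an integrable envelope. Centred sums are o_P(n^{3/4}) by Chebyshev, so everything vanishes at the
rate o_P(n^{-1/4}). Since θ̌ factors out of the sums, its dependence on the sample is harmless and
no empirical process theory is needed (`tendstoInMeasure_sqrt_mul_deltaHat_sub`). The central limit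
theorem at θ̄ then gives asymptotic normality.

For the variance, φ is locally Lipschitz in θ with a square integrable constant, so the first two
empirical moments at θ̌ and at θ̄ have the same limits (`tendstoInMeasure_sigmaHatSq`). Slutsky's
argument yields the coverage (`tendsto_studentized_coverage`). -/

noncomputable section

namespace RelErr

/-! ### Convergence in probability and averages of i.i.d. samples -/

section InProbability

variable {Ω : Type*} [MeasurableSpace Ω] {P : Measure Ω}

/-- Convergence in probability of two sequences is joint. -/
theorem tendstoInMeasure_prodMk {E F : Type*} [PseudoEMetricSpace E] [PseudoEMetricSpace F]
    {X : ℕ → Ω → E} {Y : ℕ → Ω → F} {f : Ω → E} {g : Ω → F}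
    (hX : TendstoInMeasure P X atTop f) (hY : TendstoInMeasure P Y atTop g) :
    TendstoInMeasure P (fun n ω => (X n ω, Y n ω)) atTop (fun ω => (f ω, g ω)) := by
  intro ε hε
  have h := (hX ε hε).add (hY ε hε)
  rw [add_zero] at h
  refine tendsto_of_tendsto_of_tendsto_of_le_of_le tendsto_const_nhds h (fun _ => zero_le)
    (fun n => ?_)
  refine (measure_mono fun ω hω => ?_).trans (measure_union_le _ _)
  simp only [Set.mem_ofPred_eq, Prod.edist_eq, le_max_iff] at hω
  exact hω

/-- Continuous mapping in probability, in a form that allows eventual domination: if `F` converges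
along every subsequence of every path along which `X` converges, then it converges in
probability when `X` does. -/
theorem tendstoInMeasure_of_pathwise [IsFiniteMeasure P] {E E' : Type*} [PseudoEMetricSpace E]
    [PseudoEMetricSpace E'] {X : ℕ → Ω → E} {c : E} {F : ℕ → Ω → E'} {d : E'}
    (hX : TendstoInMeasure P X atTop (fun _ => c))
    (hF : ∀ n, AEStronglyMeasurable (F n) P)
    (h : ∀ ω (ns : ℕ → ℕ), Tendsto ns atTop atTop →
      Tendsto (fun k => X (ns k) ω) atTop (𝓝 c) → Tendsto (fun k => F (ns k) ω) atTop (𝓝 d)) :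
    TendstoInMeasure P F atTop (fun _ => d) := by
  -- Convergence in probability means that every subsequence has an a.e. convergent further
  -- subsequence. One along which `X` converges a.e. serves for `F`, path by path.
  rw [exists_seq_tendstoInMeasure_atTop_iff hF]
  intro ns hns
  obtain ⟨ns', hns', hae⟩ := (hX.comp hns.tendsto_atTop).exists_seq_tendsto_ae
  refine ⟨ns', hns', ?_⟩
  filter_upwards [hae] with ω hω
  exact h ω (ns ∘ ns') (hns.tendsto_atTop.comp hns'.tendsto_atTop) hω

variable {S : Type*} [MeasurableSpace S] {Q : Measure S} {W : ℕ → Ω → S}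

theorem identDistrib_sample (hWmeas : ∀ i, Measurable (W i)) (hWlaw : ∀ i, P.map (W i) = Q)
    {f : S → ℝ} (hf : Measurable f) (i : ℕ) :
    IdentDistrib (fun ω => f (W i ω)) (fun ω => f (W 0 ω)) P P :=
  (IdentDistrib.mk (hWmeas i).aemeasurable (hWmeas 0).aemeasurable
    ((hWlaw i).trans (hWlaw 0).symm)).comp hf

theorem memLp_sample (hWmeas : ∀ i, Measurable (W i)) (hWlaw : ∀ i, P.map (W i) = Q)
    {f : S → ℝ} {p : ENNReal} (hf : MemLp f p Q) (i : ℕ) : MemLp (fun ω => f (W i ω)) p P := by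
  rw [← hWlaw i] at hf
  exact hf.comp_of_map (hWmeas i).aemeasurable

theorem integral_sample (hWmeas : ∀ i, Measurable (W i)) (hWlaw : ∀ i, P.map (W i) = Q)
    {f : S → ℝ} (hf : Measurable f) (i : ℕ) : ∫ ω, f (W i ω) ∂P = ∫ w, f w ∂Q := by
  rw [← hWlaw i, integral_map (hWmeas i).aemeasurable hf.aestronglyMeasurable]

theorem variance_sample (hWmeas : ∀ i, Measurable (W i)) (hWlaw : ∀ i, P.map (W i) = Q)
    {f : S → ℝ} (hf : Measurable f) (i : ℕ) :
    variance (fun ω => f (W i ω)) P = variance f Q := by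
  rw [← hWlaw i, variance_map hf.aemeasurable (hWmeas i).aemeasurable]
  rfl

/-- The law of large numbers in probability, for a function of an i.i.d. sample. -/
theorem tendstoInMeasure_average [IsProbabilityMeasure P] (hWmeas : ∀ i, Measurable (W i))
    (hWindep : iIndepFun W P) (hWlaw : ∀ i, P.map (W i) = Q)
    {f : S → ℝ} (hf : Measurable f) (hint : Integrable f Q) :
    TendstoInMeasure P (fun (n : ℕ) ω => (1 / (n : ℝ)) * ∑ i ∈ Finset.range n, f (W i ω)) atTop
      (fun _ => ∫ w, f w ∂Q) := by
  refine tendstoInMeasure_of_tendsto_ae (fun n => ?_) ?_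
  · have : Measurable fun ω => (1 / (n : ℝ)) * ∑ i ∈ Finset.range n, f (W i ω) :=
      (Finset.measurable_sum _ fun i _ => hf.comp (hWmeas i)).const_mul _
    exact this.aestronglyMeasurable
  have h := strong_law_ae_real (μ := P) (fun i ω => f (W i ω))
    (memLp_one_iff_integrable.1 (memLp_sample hWmeas hWlaw (memLp_one_iff_integrable.2 hint) 0))
    (fun i j hij => (hWindep.indepFun hij).comp hf hf)
    (fun i => identDistrib_sample hWmeas hWlaw hf i)
  filter_upwards [h] with ω hω
  rw [integral_sample hWmeas hWlaw hf 0] at hω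
  refine hω.congr fun n => ?_
  ring

/-- Centred sums of square integrable terms are `o_P(n^{3/4})`. -/
theorem tendstoInMeasure_centred_sum [IsProbabilityMeasure P] (hWmeas : ∀ i, Measurable (W i))
    (hWindep : iIndepFun W P) (hWlaw : ∀ i, P.map (W i) = Q)
    {f : S → ℝ} (hf : Measurable f) (hf2 : MemLp f 2 Q) (h0 : ∫ w, f w ∂Q = 0) :
    TendstoInMeasure P
      (fun (n : ℕ) ω => ((n : ℝ) ^ (3 / 4 : ℝ))⁻¹ * ∑ i ∈ Finset.range n, f (W i ω)) atTop
      (fun _ => 0) := by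
  have hL2 : ∀ n : ℕ, MemLp
      (fun ω => ((n : ℝ) ^ (3 / 4 : ℝ))⁻¹ * ∑ i ∈ Finset.range n, f (W i ω)) 2 P := fun n =>
    (memLp_finsetSum (Finset.range n) fun i _ => memLp_sample hWmeas hWlaw hf2 i).const_mul _
  have hmean : ∀ n : ℕ, ∫ ω, ((n : ℝ) ^ (3 / 4 : ℝ))⁻¹ * ∑ i ∈ Finset.range n, f (W i ω) ∂P
      = 0 := by
    intro n
    rw [integral_const_mul, integral_finsetSum _ fun i _ =>
      (memLp_sample hWmeas hWlaw hf2 i).integrable one_le_two]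
    simp [integral_sample hWmeas hWlaw hf, h0]
  have hvar : ∀ n : ℕ, variance
      (fun ω => ((n : ℝ) ^ (3 / 4 : ℝ))⁻¹ * ∑ i ∈ Finset.range n, f (W i ω)) P
      = (((n : ℝ) ^ (3 / 4 : ℝ))⁻¹) ^ 2 * (n * variance f Q) := by
    intro n
    rw [variance_const_mul]
    have := IndepFun.variance_sum (μ := P) (X := fun i ω => f (W i ω)) (s := Finset.range n)
      (fun i _ => memLp_sample hWmeas hWlaw hf2 i)
      (fun i _ j _ hij => (hWindep.indepFun hij).comp hf hf)
    simp only [variance_sample hWmeas hWlaw hf, Finset.sum_const, Finset.card_range,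
      nsmul_eq_mul] at this
    rw [← this]
    congr 2
    ext ω
    simp
  rw [tendstoInMeasure_iff_norm]
  intro ε hε
  -- The Chebyshev bound: the variance of the scaled sum is n^{-3/2} · n Var f = n^{-1/2} Var f.
  have hlim : Tendsto (fun n : ℕ => ENNReal.ofReal
      ((((n : ℝ) ^ (3 / 4 : ℝ))⁻¹) ^ 2 * (n * variance f Q) / ε ^ 2)) atTop (𝓝 0) := by
    rw [← ENNReal.ofReal_zero]
    refine (ENNReal.continuous_ofReal.tendsto 0).comp ?_
    have h1 : Tendsto (fun n : ℕ => (n : ℝ) ^ (-(1 / 2) : ℝ) * (variance f Q / ε ^ 2)) atTop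
        (𝓝 (0 * (variance f Q / ε ^ 2))) :=
      ((tendsto_rpow_neg_atTop (by norm_num : (0 : ℝ) < 1 / 2)).comp
        tendsto_natCast_atTop_atTop).mul_const _
    rw [zero_mul] at h1
    refine h1.congr' ?_
    filter_upwards [eventually_gt_atTop 0] with n hn
    have hn' : (0 : ℝ) < n := by exact_mod_cast hn
    have : (((n : ℝ) ^ (3 / 4 : ℝ))⁻¹) ^ 2 * n = (n : ℝ) ^ (-(1 / 2) : ℝ) := by
      rw [← Real.rpow_neg hn'.le, ← Real.rpow_natCast, ← Real.rpow_mul hn'.le]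
      nth_rewrite 2 [← Real.rpow_one (n : ℝ)]
      rw [← Real.rpow_add hn']
      norm_num
    rw [← this]
    ring
  refine tendsto_of_tendsto_of_tendsto_of_le_of_le tendsto_const_nhds hlim (fun _ => zero_le)
    (fun n => ?_)
  have := meas_ge_le_variance_div_sq (hL2 n) hε
  rw [hmean n, hvar n] at this
  simpa [Real.norm_eq_abs] using this

end InProbability

/-! ### Normal quantiles and Slutsky's argument -/

section Gaussian

theorem gaussianReal_real_Iio_neg (z : ℝ) :
    (gaussianReal 0 1).real (Set.Iio (-z)) = 1 - cdf (gaussianReal 0 1) z := by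
  have hmap : (gaussianReal 0 1).map (fun x => -x) = gaussianReal 0 1 := by
    simpa using gaussianReal_map_neg (μ := 0) (v := 1)
  have h : (gaussianReal 0 1).real (Set.Iio (-z)) = (gaussianReal 0 1).real (Set.Iic z)ᶜ := by
    conv_lhs => rw [← hmap]
    rw [map_measureReal_apply measurable_neg measurableSet_Iio]
    congr 1
    ext x
    simp
  rw [h, probReal_compl_eq_one_sub measurableSet_Iic, cdf_eq_real]

/-- A jump of the distribution function is the mass of a point, and the Gaussian has no atoms. -/
theorem continuous_cdf_gaussianReal : Continuous (cdf (gaussianReal 0 1)) := by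
  have hna := nullSingletonClass_gaussianReal (μ := 0) (v := 1) one_ne_zero
  refine continuous_iff_continuousAt.2 fun x => ?_
  rw [(monotone_cdf _).continuousAt_iff_leftLim_eq_rightLim, StieltjesFunction.rightLim_eq]
  have h := (cdf (gaussianReal 0 1)).measure_singleton x
  rw [measure_cdf, measure_singleton, eq_comm, ENNReal.ofReal_eq_zero] at h
  exact le_antisymm ((monotone_cdf _).leftLim_le le_rfl) (by linarith)

/-- The symmetric interval bounded by the `1 - η / 2` quantile has standard normal
probability `1 - η`. -/
theorem gaussianReal_abs_le_normalQuantile {η : ℝ} (h0 : 0 < η) (h1 : η < 1) :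
    0 ≤ normalQuantile (1 - η / 2) ∧
    (gaussianReal 0 1).real {x | |x| ≤ normalQuantile (1 - η / 2)} = 1 - η := by
  have hmono := monotone_cdf (gaussianReal 0 1)
  set F := cdf (gaussianReal 0 1) with hF
  set z := normalQuantile (1 - η / 2) with hz
  have hbdd : BddBelow {t : ℝ | 1 - η / 2 ≤ F t} := by
    obtain ⟨a, ha⟩ := ((tendsto_cdf_atBot (gaussianReal 0 1)).eventually
      (gt_mem_nhds (show (0 : ℝ) < 1 - η / 2 by linarith))).exists
    refine ⟨a, fun t ht => ?_⟩
    by_contra! hta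
    have := hmono hta.le
    simp only [Set.mem_ofPred_eq] at ht
    linarith
  obtain ⟨a, ha⟩ := ((tendsto_cdf_atBot (gaussianReal 0 1)).eventually
    (gt_mem_nhds (show (0 : ℝ) < 1 - η / 2 by linarith))).exists
  obtain ⟨b, hb⟩ := ((tendsto_cdf_atTop (gaussianReal 0 1)).eventually
    (lt_mem_nhds (show 1 - η / 2 < (1 : ℝ) by linarith))).exists
  obtain ⟨t, ht⟩ := mem_range_of_exists_le_of_exists_ge continuous_cdf_gaussianReal
    ⟨a, ha.le⟩ ⟨b, hb.le⟩
  -- Continuity makes the infimum defining the quantile attained, and with equality, since some `t`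
  -- solves `F t = 1 - η / 2`.
  have hzF : F z = 1 - η / 2 := by
    refine le_antisymm ?_ ?_
    · rw [← ht]
      exact hmono (csInf_le hbdd ht.ge)
    · exact (isClosed_le continuous_const continuous_cdf_gaussianReal).csInf_mem ⟨t, ht.ge⟩ hbdd
  have hna := nullSingletonClass_gaussianReal (μ := 0) (v := 1) one_ne_zero
  -- By symmetry `F 0 = 1/2`, which is less than `1 - η / 2`.
  have hz0 : 0 ≤ z := by
    by_contra! hneg
    have h2 := gaussianReal_real_Iio_neg 0
    rw [neg_zero, measureReal_congr (Iio_ae_eq_Iic (μ := gaussianReal 0 1)), ← cdf_eq_real] at h2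
    have := hmono hneg.le
    rw [← hF] at h2
    linarith
  refine ⟨hz0, ?_⟩
  have hset : {x : ℝ | |x| ≤ z} = Set.Iic z \ Set.Iio (-z) := by
    ext x
    simp [abs_le, and_comm]
  have hsub : Set.Iio (-z) ⊆ Set.Iic z := fun x hx => (Set.mem_Iio.1 hx).le.trans (by linarith)
  rw [hset, measureReal_sdiff hsub measurableSet_Iio,
    gaussianReal_real_Iio_neg, ← cdf_eq_real, ← hF, hzF]
  ring

/-- Slutsky's argument for studentized statistics: if `U n` is asymptotically `N(0, v)` and `V n`
is a consistent estimator of `v > 0`, then the event `|U n| ≤ z √(V n)` has asymptotic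
probability `1 - η`. -/
theorem tendsto_studentized_coverage {Ω : Type*} [MeasurableSpace Ω] {P : Measure Ω}
    [IsProbabilityMeasure P] {U V : ℕ → Ω → ℝ} {v : ℝ} (hv : 0 < v)
    (hU : TendstoInDistribution U atTop (fun x : ℝ => √v * x) (fun _ => P) (gaussianReal 0 1))
    (hV : TendstoInMeasure P V atTop (fun _ => v)) (hVm : ∀ n, AEMeasurable (V n) P)
    {η : ℝ} (h0 : 0 < η) (h1 : η < 1) :
    Tendsto (fun n => P.real {ω | |U n ω| ≤ normalQuantile (1 - η / 2) * √(V n ω)}) atTop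
      (𝓝 (1 - η)) := by
  obtain ⟨hz0, hz⟩ := gaussianReal_abs_le_normalQuantile h0 h1
  set z := normalQuantile (1 - η / 2)
  -- The event is that this continuous function of `(U n, V n)` lies in `Set.Iic 0`, so joint
  -- convergence and the portmanteau theorem apply.
  have hg : Continuous fun p : ℝ × ℝ => |p.1| - z * √p.2 := by fun_prop
  have h := hU.continuous_comp_prodMk_of_tendstoInMeasure_const hg hV hVm
  have hsv : 0 < √v := Real.sqrt_pos.2 hv
  have hna := nullSingletonClass_gaussianReal (μ := 0) (v := 1) one_ne_zero
  -- The limit variable meets the boundary point 0 only at x = ±z, a null set.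
  have hfr : (gaussianReal 0 1).map (fun x : ℝ => |√v * x| - z * √v)
      (frontier (Set.Iic 0)) = 0 := by
    rw [frontier_Iic,
      Measure.map_apply_of_aemeasurable h.aemeasurable_limit (measurableSet_singleton 0)]
    refine measure_mono_null (t := {z, -z}) (fun x hx => ?_) (Set.Finite.measure_zero (by simp) _)
    simp only [Set.mem_preimage, Set.mem_singleton_iff, abs_mul, abs_of_pos hsv] at hx
    have : |x| = z := by
      have : √v * (|x| - z) = 0 := by linarith
      rcases mul_eq_zero.1 this with h | h <;> linarith
    exact eq_or_eq_neg_of_abs_eq this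
  have hlim : (gaussianReal 0 1).map (fun x : ℝ => |√v * x| - z * √v) (Set.Iic 0)
      = gaussianReal 0 1 {x | |x| ≤ z} := by
    rw [Measure.map_apply_of_aemeasurable h.aemeasurable_limit measurableSet_Iic]
    congr 1
    ext x
    simp only [Set.mem_preimage, Set.mem_Iic, abs_mul, abs_of_pos hsv, Set.mem_ofPred_eq]
    rw [mul_comm z, sub_nonpos, mul_le_mul_iff_right₀ hsv]
  have key' := ProbabilityMeasure.tendsto_measure_of_null_frontier_of_tendsto' h.tendsto hfr
  change Tendsto (fun n => P.map _ (Set.Iic 0)) atTop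
    (𝓝 ((gaussianReal 0 1).map (fun x : ℝ => |√v * x| - z * √v) (Set.Iic 0))) at key'
  rw [hlim] at key'
  have key := (ENNReal.tendsto_toReal (measure_ne_top _ _)).comp key'
  change Tendsto _ _ (𝓝 ((gaussianReal 0 1).real _)) at key
  rw [hz] at key
  refine key.congr fun n => ?_
  rw [Function.comp_apply,
    Measure.map_apply_of_aemeasurable (h.forall_aemeasurable n) measurableSet_Iic, Measure.real]
  congr 2
  ext ω
  simp

end Gaussian

/-! ### Pointwise Taylor expansion of the score -/

section Expansion

variable {𝒳 : Type*} {m : ℕ}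

theorem psModel_pos (Φ : 𝒳 → Param m) (γ : Param m) (x : 𝒳) : 0 < psModel Φ γ x := by
  unfold psModel; positivity

theorem psModel_lt_one (Φ : 𝒳 → Param m) (γ : Param m) (x : 𝒳) : psModel Φ γ x < 1 := by
  unfold psModel
  rw [div_lt_one (by positivity)]
  linarith

/-- The logistic form turns the reciprocals of e and 1 - e into exponentials of linear functions of
γ. The score is then affine in β and exponential in γ, so its Taylor remainders are explicit. -/
theorem inv_psModel (Φ : 𝒳 → Param m) (γ : Param m) (x : 𝒳) :
    (psModel Φ γ x)⁻¹ = 1 + Real.exp (-inner ℝ (Φ x) γ) := by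
  unfold psModel
  rw [Real.exp_neg]
  field_simp
  ring

theorem inv_one_sub_psModel (Φ : 𝒳 → Param m) (γ : Param m) (x : 𝒳) :
    (1 - psModel Φ γ x)⁻¹ = 1 + Real.exp (inner ℝ (Φ x) γ) := by
  unfold psModel
  have : (1 : ℝ) + Real.exp (inner ℝ (Φ x) γ) ≠ 0 := by positivity
  field_simp
  ring

theorem ipw_psModel (Φ : 𝒳 → Param m) (γ : Param m) (z : Bool × 𝒳 × ℝ) :
    ipw (psModel Φ γ) z = ind z.1 * (1 + Real.exp (-inner ℝ (Φ z.2.1) γ)) +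
      (1 - ind z.1) * (1 + Real.exp (inner ℝ (Φ z.2.1) γ)) := by
  rw [ipw, div_eq_mul_inv, div_eq_mul_inv, inv_psModel, inv_one_sub_psModel]

/-- Allows terms without an inverse probability weight to be absorbed into the weighted envelope. -/
theorem one_le_ipw (Φ : 𝒳 → Param m) (γ : Param m) (z : Bool × 𝒳 × ℝ) :
    1 ≤ ipw (psModel Φ γ) z := by
  rw [ipw_psModel]
  obtain ⟨a, x, y⟩ := z
  cases a <;> simp [ind, Real.exp_nonneg]

theorem phiModel_eq (t₁ t₂ : 𝒳 → ℝ) (Φ : 𝒳 → Param m) (γ β₀ β₁ : Param m)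
    (z : Bool × 𝒳 × ℝ) :
    phiModel t₁ t₂ Φ γ β₀ β₁ z = (t₁ z.2.1 ^ 2 - t₂ z.2.1 ^ 2) - 2 * (t₁ z.2.1 - t₂ z.2.1) *
      (ind z.1 * (z.2.2 - inner ℝ (Φ z.2.1) β₁) * (1 + Real.exp (-inner ℝ (Φ z.2.1) γ)) +
        inner ℝ (Φ z.2.1) β₁ -
        (1 - ind z.1) * (z.2.2 - inner ℝ (Φ z.2.1) β₀) * (1 + Real.exp (inner ℝ (Φ z.2.1) γ)) -
        inner ℝ (Φ z.2.1) β₀) := by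
  simp only [phiModel, phi, div_eq_mul_inv, inv_psModel, inv_one_sub_psModel, orModel]

/-- The scalar factor of `Φ` in the gradient of `phiModel` with respect to `γ`. -/
def psCoef (t₁ t₂ : 𝒳 → ℝ) (Φ : 𝒳 → Param m) (γ β₀ β₁ : Param m) (z : Bool × 𝒳 × ℝ) : ℝ :=
  2 * (t₁ z.2.1 - t₂ z.2.1) *
    (ind z.1 * (z.2.2 - inner ℝ (Φ z.2.1) β₁) * Real.exp (-inner ℝ (Φ z.2.1) γ) +
      (1 - ind z.1) * (z.2.2 - inner ℝ (Φ z.2.1) β₀) * Real.exp (inner ℝ (Φ z.2.1) γ))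

/-- The scalar factor of `Φ` in the gradient of `phiModel` with respect to `β₀`. -/
def orCoef₀ (t₁ t₂ : 𝒳 → ℝ) (Φ : 𝒳 → Param m) (γ : Param m) (z : Bool × 𝒳 × ℝ) : ℝ :=
  2 * (t₁ z.2.1 - t₂ z.2.1) *
    (ind z.1 - (1 - ind z.1) * Real.exp (inner ℝ (Φ z.2.1) γ))

/-- The scalar factor of `Φ` in the gradient of `phiModel` with respect to `β₁`. -/
def orCoef₁ (t₁ t₂ : 𝒳 → ℝ) (Φ : 𝒳 → Param m) (γ : Param m) (z : Bool × 𝒳 × ℝ) : ℝ :=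
  2 * (t₁ z.2.1 - t₂ z.2.1) *
    (ind z.1 * Real.exp (-inner ℝ (Φ z.2.1) γ) - (1 - ind z.1))

/-- The square integrable envelope of `phiModel` and of its derivatives. -/
def envelope (t₁ t₂ : 𝒳 → ℝ) (Φ : 𝒳 → Param m) (γ : Param m) (r : ℝ) (z : Bool × 𝒳 × ℝ) : ℝ :=
  |t₁ z.2.1 - t₂ z.2.1| * ipw (psModel Φ γ) z * (1 + |z.2.2|) * Real.exp (r / 2 * ‖Φ z.2.1‖)

theorem envelope_nonneg (t₁ t₂ : 𝒳 → ℝ) (Φ : 𝒳 → Param m) (γ : Param m) (r : ℝ)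
    (z : Bool × 𝒳 × ℝ) : 0 ≤ envelope t₁ t₂ Φ γ r z := by
  have := one_le_ipw Φ γ z
  unfold envelope
  positivity

/-- Powers of ‖Φ‖ up to the third, coming from residuals and Taylor terms, are paid for by part of
the exponential tilt in the moment condition. -/
theorem exists_one_add_pow_three_le {s : ℝ} (hs : 0 < s) :
    ∃ K : ℝ, 0 < K ∧ ∀ x : ℝ, 0 ≤ x → (1 + x) ^ 3 ≤ K * Real.exp (s * x) := by
  -- The constant arises by cubing `1 + x ≤ (1 + 3 / s) * exp (s * x / 3)`, a consequence of `t + 1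
  -- ≤ exp t`.
  refine ⟨(1 + 3 / s) ^ 3, by positivity, fun x hx => ?_⟩
  have h1 : 1 + x ≤ (1 + 3 / s) * Real.exp (s * x / 3) := by
    have := Real.add_one_le_exp (s * x / 3)
    have h2 : (1 + 3 / s) * (s * x / 3 + 1) ≤ (1 + 3 / s) * Real.exp (s * x / 3) := by gcongr
    have h3 : (1 + 3 / s) * (s * x / 3 + 1) = 1 + x + s * x / 3 + 3 / s := by field_simp; ring
    have : 0 ≤ s * x / 3 + 3 / s := by positivity
    linarith
  calc (1 + x) ^ 3 ≤ ((1 + 3 / s) * Real.exp (s * x / 3)) ^ 3 := by gcongr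
    _ = (1 + 3 / s) ^ 3 * Real.exp (s * x) := by
      rw [mul_pow, ← Real.exp_nat_mul]
      congr 2
      push_cast
      ring

theorem abs_exp_sub_one_le_mul_exp (q : ℝ) : |Real.exp q - 1| ≤ |q| * Real.exp |q| := by
  have := Complex.norm_exp_sub_sum_le_norm_mul_exp (q : ℂ) 1
  simp only [Finset.range_one, Finset.sum_singleton, pow_zero, Nat.factorial_zero, Nat.cast_one,
    div_one, pow_one, Complex.norm_real, Real.norm_eq_abs] at this
  exact_mod_cast this

theorem abs_exp_sub_one_sub_le_sq_mul_exp (q : ℝ) :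
    |Real.exp q - 1 - q| ≤ |q| ^ 2 * Real.exp |q| := by
  have := Complex.norm_exp_sub_sum_le_norm_mul_exp (q : ℂ) 2
  simp only [Finset.sum_range_succ, Finset.range_zero, Finset.sum_empty, zero_add, pow_zero,
    Nat.factorial_zero, Nat.factorial_one, Nat.cast_one,
    div_one, pow_one, Complex.norm_real, Real.norm_eq_abs] at this
  rw [sub_sub]
  exact_mod_cast this

/-- The second order remainder of `(b, q) ↦ (k - b) w e ^ q`. -/
theorem abs_remainder_le {k w q c x ρ s B D K : ℝ} (hw : 0 ≤ w) (hx : 0 ≤ x) (hB : 1 ≤ B)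
    (hD : 1 ≤ D) (hk : |k| ≤ B * D * (1 + x)) (hq : |q| ≤ x * ρ) (hc : |c| ≤ x * ρ)
    (hρ : 0 ≤ ρ) (hρs : ρ ≤ s) (hK : (1 + x) ^ 3 ≤ K * Real.exp (s * x)) :
    |k * w * (Real.exp q - 1 - q) - c * w * (Real.exp q - 1)| ≤
      2 * B * K * ρ ^ 2 * (w * D * Real.exp (2 * s * x)) := by
  have hs : 0 ≤ s := hρ.trans hρs
  have he : Real.exp |q| ≤ Real.exp (s * x) :=
    Real.exp_le_exp.2 (hq.trans (by rw [mul_comm]; gcongr))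
  have h1 : |k * w * (Real.exp q - 1 - q)| ≤
      B * D * (1 + x) * w * ((x * ρ) ^ 2 * Real.exp (s * x)) := by
    rw [abs_mul, abs_mul, abs_of_nonneg hw]
    have := abs_exp_sub_one_sub_le_sq_mul_exp q
    gcongr
    exact this.trans (by gcongr)
  have h2 : |c * w * (Real.exp q - 1)| ≤ x * ρ * w * (x * ρ * Real.exp (s * x)) := by
    rw [abs_mul, abs_mul, abs_of_nonneg hw]
    have := abs_exp_sub_one_le_mul_exp q
    gcongr
    exact this.trans (by gcongr)
  have hBD : 1 ≤ B * D := one_le_mul_of_one_le_of_one_le hB hD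
  calc _ ≤ _ := abs_sub _ _
    _ ≤ B * D * (1 + x) * w * ((x * ρ) ^ 2 * Real.exp (s * x)) +
        x * ρ * w * (x * ρ * Real.exp (s * x)) := add_le_add h1 h2
    _ = w * ρ ^ 2 * Real.exp (s * x) * (B * D * ((1 + x) * x ^ 2) + 1 * x ^ 2) := by ring
    -- Both polynomial factors are at most `(1 + x) ^ 3`. Trading the cube for a second factor `exp
    -- (s * x)` gives the total exponent `2 * s * x`.
    _ ≤ w * ρ ^ 2 * Real.exp (s * x) * (B * D * (1 + x) ^ 3 + B * D * (1 + x) ^ 3) := by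
      have h3 : (1 + x) * x ^ 2 ≤ (1 + x) ^ 3 := by nlinarith [mul_nonneg hx hx]
      have h4 : x ^ 2 ≤ (1 + x) ^ 3 := by nlinarith [mul_nonneg hx hx, pow_nonneg hx 3]
      gcongr
    _ = 2 * B * ρ ^ 2 * w * D * Real.exp (s * x) * (1 + x) ^ 3 := by ring
    _ ≤ 2 * B * ρ ^ 2 * w * D * Real.exp (s * x) * (K * Real.exp (s * x)) := by gcongr
    _ = 2 * B * K * ρ ^ 2 * (w * D * Real.exp (2 * s * x)) := by
      rw [show 2 * s * x = s * x + s * x by ring, Real.exp_add]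
      ring

theorem abs_sub_inner_le {v β : Param m} {y B : ℝ} (hβ : ‖β‖ ≤ B) (hB : 1 ≤ B) :
    |y - inner ℝ v β| ≤ B * (1 + |y|) * (1 + ‖v‖) := by
  have h1 := abs_real_inner_le_norm v β
  have h2 : ‖v‖ * ‖β‖ ≤ ‖v‖ * B := by gcongr
  have h3 := abs_sub y (inner ℝ v β)
  nlinarith [abs_nonneg y, norm_nonneg v, mul_nonneg (abs_nonneg y) (norm_nonneg v),
    mul_nonneg (sub_nonneg.2 hB) (abs_nonneg y),
    mul_nonneg (mul_nonneg (zero_le_one.trans hB) (abs_nonneg y)) (norm_nonneg v)]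

/-- First order expansion of `phiModel` with a quadratic remainder, dominated by the envelope. -/
theorem exists_phiModel_expansion (t₁ t₂ : 𝒳 → ℝ) (Φ : 𝒳 → Param m) (γ β₀ β₁ : Param m)
    {r : ℝ} (hr : 0 < r) :
    ∃ C : ℝ, 0 < C ∧ ∀ (z : Bool × 𝒳 × ℝ) (u b₀ b₁ : Param m) (ρ : ℝ),
      ‖u‖ ≤ ρ → ‖b₀‖ ≤ ρ → ‖b₁‖ ≤ ρ → ρ ≤ r / 4 →
      |phiModel t₁ t₂ Φ (γ + u) (β₀ + b₀) (β₁ + b₁) z - phiModel t₁ t₂ Φ γ β₀ β₁ z -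
        (psCoef t₁ t₂ Φ γ β₀ β₁ z * inner ℝ (Φ z.2.1) u +
          orCoef₀ t₁ t₂ Φ γ z * inner ℝ (Φ z.2.1) b₀ +
          orCoef₁ t₁ t₂ Φ γ z * inner ℝ (Φ z.2.1) b₁)| ≤
        C * ρ ^ 2 * envelope t₁ t₂ Φ γ r z := by
  -- The envelope has exponent r/2: one quarter of r controls the perturbation of γ, of norm at most
  -- r/4, and another the cubic polynomial.
  obtain ⟨K, hK0, hK⟩ := exists_one_add_pow_three_le (show 0 < r / 4 by positivity)
  set B := 1 + ‖β₀‖ + ‖β₁‖ with hB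
  have hB1 : 1 ≤ B := by have := norm_nonneg β₀; have := norm_nonneg β₁; linarith
  have hB0 : ‖β₀‖ ≤ B := by have := norm_nonneg β₁; linarith
  have hB2 : ‖β₁‖ ≤ B := by have := norm_nonneg β₀; linarith
  refine ⟨2 * (2 * B * K), by positivity, fun z u b₀ b₁ ρ hu hb₀ hb₁ hρ => ?_⟩
  obtain ⟨a, x, y⟩ := z
  have hρ0 : 0 ≤ ρ := (norm_nonneg u).trans hu
  have hin : ∀ v : Param m, ‖v‖ ≤ ρ → |inner ℝ (Φ x) v| ≤ ‖Φ x‖ * ρ := fun v hv =>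
    (abs_real_inner_le_norm _ _).trans (by gcongr)
  have hD : 1 ≤ 1 + |y| := by linarith [abs_nonneg y]
  have hs : 2 * (r / 4) * ‖Φ x‖ = r / 2 * ‖Φ x‖ := by ring
  simp only [phiModel_eq, envelope, ipw_psModel, psCoef, orCoef₀, orCoef₁, inner_add_right]
  set h := t₁ x - t₂ x
  set p := inner ℝ (Φ x) γ
  set q := inner ℝ (Φ x) u with hqdef
  -- The remainder carries the odds `w`, while the inverse probability weight in the envelope is `1
  -- + w`.
  have hfin : ∀ w R : ℝ, 0 ≤ w →
      |R| ≤ 2 * B * K * ρ ^ 2 * (w * (1 + |y|) * Real.exp (2 * (r / 4) * ‖Φ x‖)) →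
      |2 * h * R| ≤ 2 * (2 * B * K) * ρ ^ 2 *
        (|h| * (1 + w) * (1 + |y|) * Real.exp (r / 2 * ‖Φ x‖)) := by
    intro w R hw hR
    rw [hs] at hR
    rw [abs_mul, abs_mul, abs_two]
    calc 2 * |h| * |R|
        ≤ 2 * |h| * (2 * B * K * ρ ^ 2 * ((1 + w) * (1 + |y|) * Real.exp (r / 2 * ‖Φ x‖))) := by
          gcongr
          refine hR.trans ?_
          gcongr
          linarith
      _ = _ := by ring
  cases a
  · convert hfin _ _ (Real.exp_nonneg p) (abs_remainder_le (Real.exp_nonneg p)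
      (norm_nonneg (Φ x)) hB1 hD (abs_sub_inner_le (v := Φ x) (y := y) hB0 hB1) (hin u hu)
      (hin b₀ hb₀) hρ0 hρ (hK _ (norm_nonneg _))) using 1
    · simp only [ind, Bool.false_eq_true, if_false, Real.exp_add]
      congr 1
      ring
    · simp [ind]
  -- The treated arm has odds exp(-p), so γ is perturbed through -q. The contribution to φ also
  -- changes sign, which the absolute value removes.
  · convert hfin _ _ (Real.exp_nonneg (-p)) (abs_remainder_le (q := -q) (Real.exp_nonneg (-p))
      (norm_nonneg (Φ x)) hB1 hD (abs_sub_inner_le (v := Φ x) (y := y) hB2 hB1)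
      (by rw [abs_neg]; exact hin u hu) (hin b₁ hb₁) hρ0 hρ (hK _ (norm_nonneg _))) using 1
    · rw [← abs_neg]
      simp only [ind, if_true, neg_add, Real.exp_add]
      congr 1
      ring
    · simp [ind]

/-- The gradient of `phiModel` is dominated by the envelope. -/
theorem exists_coef_bound (t₁ t₂ : 𝒳 → ℝ) (Φ : 𝒳 → Param m) (γ β₀ β₁ : Param m)
    {r : ℝ} (hr : 0 < r) :
    ∃ C : ℝ, 0 < C ∧ ∀ z : Bool × 𝒳 × ℝ,
      |psCoef t₁ t₂ Φ γ β₀ β₁ z| * (1 + ‖Φ z.2.1‖) ≤ C * envelope t₁ t₂ Φ γ r z ∧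
      |orCoef₀ t₁ t₂ Φ γ z| * (1 + ‖Φ z.2.1‖) ≤ C * envelope t₁ t₂ Φ γ r z ∧
      |orCoef₁ t₁ t₂ Φ γ z| * (1 + ‖Φ z.2.1‖) ≤ C * envelope t₁ t₂ Φ γ r z := by
  obtain ⟨K, hK0, hK⟩ := exists_one_add_pow_three_le (show 0 < r / 2 by positivity)
  set B := 1 + ‖β₀‖ + ‖β₁‖ with hB
  have hB1 : 1 ≤ B := by have := norm_nonneg β₀; have := norm_nonneg β₁; linarith
  have hB0 : ‖β₀‖ ≤ B := by have := norm_nonneg β₁; linarith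
  have hB2 : ‖β₁‖ ≤ B := by have := norm_nonneg β₀; linarith
  refine ⟨2 * B * K, by positivity, fun z => ?_⟩
  have hW := one_le_ipw Φ γ z
  have key : ∀ R : ℝ, |R| ≤ ipw (psModel Φ γ) z * (B * (1 + |z.2.2|) * (1 + ‖Φ z.2.1‖)) →
      |2 * (t₁ z.2.1 - t₂ z.2.1) * R| * (1 + ‖Φ z.2.1‖) ≤
        2 * B * K * envelope t₁ t₂ Φ γ r z := by
    intro R hR
    rw [abs_mul, abs_mul, abs_two]
    have h2 : (1 + ‖Φ z.2.1‖) ^ 2 ≤ K * Real.exp (r / 2 * ‖Φ z.2.1‖) :=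
      (pow_le_pow_right₀ (by linarith [norm_nonneg (Φ z.2.1)]) (by norm_num)).trans
        (hK _ (norm_nonneg _))
    calc 2 * |t₁ z.2.1 - t₂ z.2.1| * |R| * (1 + ‖Φ z.2.1‖)
        ≤ 2 * |t₁ z.2.1 - t₂ z.2.1| *
          (ipw (psModel Φ γ) z * (B * (1 + |z.2.2|) * (1 + ‖Φ z.2.1‖))) * (1 + ‖Φ z.2.1‖) := by
          gcongr
      _ = 2 * |t₁ z.2.1 - t₂ z.2.1| * ipw (psModel Φ γ) z * B * (1 + |z.2.2|) *
          (1 + ‖Φ z.2.1‖) ^ 2 := by ring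
      _ ≤ 2 * |t₁ z.2.1 - t₂ z.2.1| * ipw (psModel Φ γ) z * B * (1 + |z.2.2|) *
          (K * Real.exp (r / 2 * ‖Φ z.2.1‖)) := by gcongr
      _ = _ := by unfold envelope; ring
  have hone : 1 ≤ B * (1 + |z.2.2|) * (1 + ‖Φ z.2.1‖) :=
    one_le_mul_of_one_le_of_one_le (one_le_mul_of_one_le_of_one_le hB1
      (by linarith [abs_nonneg z.2.2])) (by linarith [norm_nonneg (Φ z.2.1)])
  -- The derivatives in β₀ and β₁ involve no outcome, so the missing factors, all at least 1, are
  -- inserted for free.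
  have hor : ∀ R : ℝ, |R| ≤ ipw (psModel Φ γ) z →
      |R| ≤ ipw (psModel Φ γ) z * (B * (1 + |z.2.2|) * (1 + ‖Φ z.2.1‖)) := fun R hR =>
    hR.trans (le_mul_of_one_le_right (by linarith) hone)
  refine ⟨key _ ?_, key _ (hor _ ?_), key _ (hor _ ?_)⟩
  · rw [ipw_psModel]
    obtain ⟨a, x, y⟩ := z
    cases a
    · simp only [ind, Bool.false_eq_true, if_false, zero_mul, sub_zero, one_mul, zero_add, abs_mul,
        Real.abs_exp]
      rw [mul_comm]
      have := abs_sub_inner_le (v := Φ x) (y := y) hB0 hB1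
      gcongr
      linarith
    · simp only [ind, if_true, sub_self, zero_mul, add_zero, one_mul, abs_mul, Real.abs_exp]
      rw [mul_comm]
      have := abs_sub_inner_le (v := Φ x) (y := y) hB2 hB1
      gcongr
      linarith
  · rw [ipw_psModel]
    obtain ⟨a, x, y⟩ := z
    cases a <;> simp [ind, Real.exp_nonneg]
  · rw [ipw_psModel]
    obtain ⟨a, x, y⟩ := z
    cases a <;> simp [ind, Real.exp_nonneg]

/-- `phiModel` is locally Lipschitz in the parameters, with the envelope as Lipschitz constant. -/
theorem exists_phiModel_lipschitz (t₁ t₂ : 𝒳 → ℝ) (Φ : 𝒳 → Param m) (γ β₀ β₁ : Param m)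
    {r : ℝ} (hr : 0 < r) :
    ∃ C : ℝ, 0 < C ∧ ∀ (z : Bool × 𝒳 × ℝ) (u b₀ b₁ : Param m) (ρ : ℝ),
      ‖u‖ ≤ ρ → ‖b₀‖ ≤ ρ → ‖b₁‖ ≤ ρ → ρ ≤ r / 4 → ρ ≤ 1 →
      |phiModel t₁ t₂ Φ (γ + u) (β₀ + b₀) (β₁ + b₁) z - phiModel t₁ t₂ Φ γ β₀ β₁ z| ≤
        C * ρ * envelope t₁ t₂ Φ γ r z := by
  obtain ⟨C, hC, h⟩ := exists_phiModel_expansion t₁ t₂ Φ γ β₀ β₁ hr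
  obtain ⟨C', hC', h'⟩ := exists_coef_bound t₁ t₂ Φ γ β₀ β₁ hr
  refine ⟨C + 3 * C', by positivity, fun z u b₀ b₁ ρ hu hb₀ hb₁ hρ hρ1 => ?_⟩
  have hρ0 : 0 ≤ ρ := (norm_nonneg u).trans hu
  have hexp := h z u b₀ b₁ ρ hu hb₀ hb₁ hρ
  obtain ⟨hp, h0, h1⟩ := h' z
  have hE := envelope_nonneg t₁ t₂ Φ γ r z
  have hlin : ∀ (c : ℝ) (v : Param m), ‖v‖ ≤ ρ →
      |c| * (1 + ‖Φ z.2.1‖) ≤ C' * envelope t₁ t₂ Φ γ r z →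
      |c * inner ℝ (Φ z.2.1) v| ≤ C' * ρ * envelope t₁ t₂ Φ γ r z := by
    intro c v hv hc
    rw [abs_mul]
    calc |c| * |inner ℝ (Φ z.2.1) v| ≤ |c| * ((1 + ‖Φ z.2.1‖) * ρ) := by
          gcongr
          refine (abs_real_inner_le_norm _ _).trans ?_
          gcongr
          linarith
      _ = |c| * (1 + ‖Φ z.2.1‖) * ρ := by ring
      _ ≤ C' * envelope t₁ t₂ Φ γ r z * ρ := by gcongr
      _ = _ := by ring
  have hL := (abs_add_three _ _ _).trans
    (add_le_add (add_le_add (hlin _ u hu hp) (hlin _ b₀ hb₀ h0)) (hlin _ b₁ hb₁ h1))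
  -- Here `ρ ≤ 1` reduces the quadratic remainder to a linear one.
  have hsq : C * ρ ^ 2 * envelope t₁ t₂ Φ γ r z ≤ C * ρ * envelope t₁ t₂ Φ γ r z := by
    gcongr
    nlinarith
  have := abs_sub_abs_le_abs_sub (phiModel t₁ t₂ Φ (γ + u) (β₀ + b₀) (β₁ + b₁) z -
    phiModel t₁ t₂ Φ γ β₀ β₁ z) (psCoef t₁ t₂ Φ γ β₀ β₁ z * inner ℝ (Φ z.2.1) u +
          orCoef₀ t₁ t₂ Φ γ z * inner ℝ (Φ z.2.1) b₀ +
          orCoef₁ t₁ t₂ Φ γ z * inner ℝ (Φ z.2.1) b₁)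
  nlinarith

end Expansion

/-! ### Measurability of the score, its derivatives and the envelope -/

section Measurability

variable {𝒳 : Type*} [MeasurableSpace 𝒳] {m : ℕ}

theorem measurable_ind : Measurable ind := measurable_from_top

theorem measurable_treat : Measurable (treat : Indiv 𝒳 → Bool) := by
  unfold treat; fun_prop

theorem measurable_pot0 : Measurable (pot0 : Indiv 𝒳 → ℝ) := by
  unfold pot0; fun_prop

theorem measurable_pot1 : Measurable (pot1 : Indiv 𝒳 → ℝ) := by
  unfold pot1; fun_prop

theorem measurable_obs : Measurable (obs : Indiv 𝒳 → Bool × 𝒳 × ℝ) := by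
  have h := measurable_ind.comp (measurable_treat (𝒳 := 𝒳))
  exact measurable_treat.prodMk (measurable_covar.prodMk
    ((h.mul measurable_pot1).add ((measurable_const.sub h).mul measurable_pot0)))

/-- `phiModel` is jointly measurable in the parameters and the observation. -/
theorem measurable_phiModel_joint {t₁ t₂ : 𝒳 → ℝ} (ht₁ : Measurable t₁) (ht₂ : Measurable t₂)
    {Φ : 𝒳 → Param m} (hΦ : Measurable Φ) {Ω : Type*} [MeasurableSpace Ω]
    {g b₀ b₁ : Ω → Param m} {z : Ω → Bool × 𝒳 × ℝ} (hg : Measurable g) (hb₀ : Measurable b₀)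
    (hb₁ : Measurable b₁) (hz : Measurable z) :
    Measurable fun ω => phiModel t₁ t₂ Φ (g ω) (b₀ ω) (b₁ ω) (z ω) := by
  have hx : Measurable fun ω => (z ω).2.1 := by fun_prop
  have hy : Measurable fun ω => (z ω).2.2 := by fun_prop
  have ha : Measurable fun ω => ind (z ω).1 := measurable_ind.comp (by fun_prop)
  have h1 := ht₁.comp hx
  have h2 := ht₂.comp hx
  have h3 := hΦ.comp hx
  simp only [Function.comp_def] at h1 h2 h3
  simp only [phiModel_eq]
  fun_prop

theorem measurable_phiModel {t₁ t₂ : 𝒳 → ℝ} (ht₁ : Measurable t₁) (ht₂ : Measurable t₂)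
    {Φ : 𝒳 → Param m} (hΦ : Measurable Φ) (γ β₀ β₁ : Param m) :
    Measurable (phiModel t₁ t₂ Φ γ β₀ β₁) :=
  measurable_phiModel_joint ht₁ ht₂ hΦ measurable_const measurable_const measurable_const
    measurable_id

theorem measurable_coefs {t₁ t₂ : 𝒳 → ℝ} (ht₁ : Measurable t₁) (ht₂ : Measurable t₂)
    {Φ : 𝒳 → Param m} (hΦ : Measurable Φ) (γ β₀ β₁ : Param m) (r : ℝ) :
    Measurable (psCoef t₁ t₂ Φ γ β₀ β₁) ∧ Measurable (orCoef₀ t₁ t₂ Φ γ) ∧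
      Measurable (orCoef₁ t₁ t₂ Φ γ) ∧ Measurable (envelope t₁ t₂ Φ γ r) := by
  have hx : Measurable fun z : Bool × 𝒳 × ℝ => z.2.1 := by fun_prop
  have ha : Measurable fun z : Bool × 𝒳 × ℝ => ind z.1 := measurable_ind.comp (by fun_prop)
  have h1 := ht₁.comp hx
  have h2 := ht₂.comp hx
  have h3 := hΦ.comp hx
  simp only [Function.comp_def] at h1 h2 h3
  unfold psCoef orCoef₀ orCoef₁ envelope
  simp only [ipw_psModel]
  refine ⟨?_, ?_, ?_, ?_⟩ <;> fun_prop

end Measurability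

/-! ### Square integrability from the envelope -/

section Moments

variable {𝒳 : Type*} [MeasurableSpace 𝒳] {m : ℕ} {Q : Measure (Indiv 𝒳)}
  {t₁ t₂ : 𝒳 → ℝ} {Φ : 𝒳 → Param m} {γ : Param m} {r : ℝ}

/-- The squared envelope is at most twice the integrand of the moment condition, because `(1 + |y|)²
≤ 2 (1 + y²)`. -/
theorem memLp_envelope (ht₁ : Measurable t₁) (ht₂ : Measurable t₂) (hΦ : Measurable Φ)
    (hint : Integrable (fun w : Indiv 𝒳 =>
      (t₁ (covar w) - t₂ (covar w)) ^ 2 * (1 + (obs w).2.2 ^ 2) *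
        ipw (psModel Φ γ) (obs w) ^ 2 * Real.exp (r * ‖Φ (covar w)‖)) Q) :
    MemLp (fun w => envelope t₁ t₂ Φ γ r (obs w)) 2 Q := by
  have hm : Measurable fun w : Indiv 𝒳 => envelope t₁ t₂ Φ γ r (obs w) :=
    ((measurable_coefs ht₁ ht₂ hΦ γ 0 0 r).2.2.2).comp measurable_obs
  rw [memLp_two_iff_integrable_sq hm.aestronglyMeasurable]
  refine (hint.const_mul 2).mono' (hm.pow_const 2).aestronglyMeasurable (ae_of_all _ fun w => ?_)
  rw [Real.norm_eq_abs, abs_of_nonneg (sq_nonneg _)]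
  have hexp : Real.exp (r / 2 * ‖Φ (covar w)‖) ^ 2 = Real.exp (r * ‖Φ (covar w)‖) := by
    rw [← Real.exp_nat_mul]; congr 1; push_cast; ring
  have hy : (1 + |(obs w).2.2|) ^ 2 ≤ 2 * (1 + (obs w).2.2 ^ 2) := by
    nlinarith [sq_abs (obs w).2.2, sq_nonneg (1 - |(obs w).2.2|)]
  change (|t₁ (covar w) - t₂ (covar w)| * ipw (psModel Φ γ) (obs w) * (1 + |(obs w).2.2|) *
    Real.exp (r / 2 * ‖Φ (covar w)‖)) ^ 2 ≤ _
  calc _ = (t₁ (covar w) - t₂ (covar w)) ^ 2 * ipw (psModel Φ γ) (obs w) ^ 2 *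
        (1 + |(obs w).2.2|) ^ 2 * Real.exp (r * ‖Φ (covar w)‖) := by
        rw [← hexp, ← sq_abs (t₁ (covar w) - t₂ (covar w))]; ring
    _ ≤ (t₁ (covar w) - t₂ (covar w)) ^ 2 * ipw (psModel Φ γ) (obs w) ^ 2 *
        (2 * (1 + (obs w).2.2 ^ 2)) * Real.exp (r * ‖Φ (covar w)‖) := by gcongr
    _ = _ := by ring

theorem memLp_of_le_envelope {f : Indiv 𝒳 → ℝ} (hf : Measurable f)
    (henv : MemLp (fun w => envelope t₁ t₂ Φ γ r (obs w)) 2 Q) {C : ℝ}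
    (h : ∀ w, |f w| ≤ C * envelope t₁ t₂ Φ γ r (obs w)) : MemLp f 2 Q := by
  refine (henv.const_mul C).mono hf.aestronglyMeasurable (ae_of_all _ fun w => ?_)
  rw [Real.norm_eq_abs, Real.norm_eq_abs]
  exact (h w).trans (le_abs_self _)

theorem memLp_outcome [IsFiniteMeasure Q] (h0 : MemLp (fun w : Indiv 𝒳 => pot0 w) 2 Q)
    (h1 : MemLp (fun w : Indiv 𝒳 => pot1 w) 2 Q) :
    MemLp (fun w : Indiv 𝒳 => (obs w).2.2) 2 Q := by
  refine (h0.norm.add h1.norm).mono measurable_obs.snd.snd.aestronglyMeasurable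
    (ae_of_all _ fun w => ?_)
  have ha := abs_nonneg (pot0 w)
  have hb := abs_nonneg (pot1 w)
  simp only [obs, Pi.add_apply, Real.norm_eq_abs]
  rw [abs_of_nonneg (add_nonneg ha hb)]
  cases treat w <;> simp [ind]

end Moments

/-! ### Identification by inverse probability weighting -/

section Identification

variable {𝒳 : Type*} [MeasurableSpace 𝒳] {Q : Measure (Indiv 𝒳)} [IsProbabilityMeasure Q]

/-- The conditional probability of treatment arm `b`, expressed through the propensity score. -/
theorem condExp_treat_eq {e : 𝒳 → ℝ} (hps : propensity Q =ᵐ[Q] fun w => e (covar w)) (b : Bool) :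
    Q[(treat ⁻¹' {b}).indicator (fun _ => (1 : ℝ)) | sigmaX 𝒳] =ᵐ[Q]
      fun w => if b then e (covar w) else 1 - e (covar w) := by
  have hint : Integrable (fun w : Indiv 𝒳 => ind (treat w)) Q := by
    refine (integrable_const (1 : ℝ)).mono'
      (measurable_ind.comp measurable_treat).aestronglyMeasurable (ae_of_all _ fun w => ?_)
    cases treat w <;> simp [ind]
  cases b
  · have h : (treat ⁻¹' {false}).indicator (fun _ => (1 : ℝ)) =
        (fun _ : Indiv 𝒳 => (1 : ℝ)) - fun w => ind (treat w) := by
      ext w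
      by_cases hw : treat w <;> simp [ind, Set.indicator, hw]
    rw [h]
    filter_upwards [condExp_sub (integrable_const (1 : ℝ)) hint (sigmaX 𝒳), hps] with w hw hw'
    rw [hw, condExp_const sigmaX_le, Pi.sub_apply]
    simp only [propensity] at hw'
    simp [hw']
  · have h : (treat ⁻¹' {true}).indicator (fun _ => (1 : ℝ)) =
        fun w : Indiv 𝒳 => ind (treat w) := by
      ext w
      by_cases hw : treat w <;> simp [ind, Set.indicator, hw]
    rw [h]
    simpa [propensity] using hps

variable [StandardBorelSpace 𝒳]

/-- Under ignorability the law of `(X, Y(0), Y(1))` on a treatment arm has the conditional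
probability of that arm as its density. -/
theorem map_withDensity_arm (hign : StronglyIgnorable Q) {e : 𝒳 → ℝ} (he : Measurable e)
    (he0 : ∀ x, 0 ≤ e x) (he1 : ∀ x, e x ≤ 1)
    (hps : propensity Q =ᵐ[Q] fun w => e (covar w)) (b : Bool) :
    (Q.restrict (treat ⁻¹' {b})).map (fun w => (covar w, pot0 w, pot1 w)) =
      (Q.withDensity fun w => ENNReal.ofReal (if b then e (covar w) else 1 - e (covar w))).map
        (fun w => (covar w, pot0 w, pot1 w)) := by
  have hmeas : Measurable fun w : Indiv 𝒳 => (covar w, pot0 w, pot1 w) :=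
    measurable_covar.prodMk (measurable_pot0.prodMk measurable_pot1)
  have hmeas2 : Measurable fun w : Indiv 𝒳 => (pot0 w, pot1 w) :=
    measurable_pot0.prodMk measurable_pot1
  set π : Indiv 𝒳 → ℝ := fun w => if b then e (covar w) else 1 - e (covar w) with hπ
  have hπX : Measurable fun x => if b then e x else 1 - e x := by
    cases b
    · simpa using he.const_sub 1
    · simpa using he
  have hπm : Measurable π := hπX.comp measurable_covar
  have hπ0 : ∀ w, 0 ≤ π w := fun w => by
    cases b <;> simp [hπ, he0, he1]
  have hπ1 : ∀ w, π w ≤ 1 := fun w => by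
    cases b <;> simp [hπ, he0, he1]
  have hπσ : StronglyMeasurable[sigmaX 𝒳] π :=
    (hπX.comp (comap_measurable covar)).stronglyMeasurable
  -- Rectangles suffice: `s` tests the covariates, where conditioning on X is used, and `t` the
  -- potential outcomes, where ignorability is used.
  refine Measure.ext_prod fun {s t} hs ht => ?_
  rw [Measure.map_apply hmeas (hs.prod ht), Measure.map_apply hmeas (hs.prod ht),
    Measure.restrict_apply (hmeas (hs.prod ht)), withDensity_apply _ (hmeas (hs.prod ht))]
  have hci := (condIndepFun_iff_condExp_inter_preimage_eq_mul hmeas2 measurable_treat).1 hign.1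
    t {b} ht (measurableSet_singleton b)
  set T : Set (Indiv 𝒳) := (fun w => (pot0 w, pot1 w)) ⁻¹' t with hT
  have hTm : MeasurableSet T := hmeas2 ht
  have hBm : MeasurableSet (treat ⁻¹' {b} : Set (Indiv 𝒳)) :=
    measurable_treat (measurableSet_singleton b)
  have hsm : MeasurableSet[sigmaX 𝒳] (covar ⁻¹' s : Set (Indiv 𝒳)) := ⟨s, hs, rfl⟩
  have hsm' : MeasurableSet (covar ⁻¹' s : Set (Indiv 𝒳)) := measurable_covar hs
  have hpre : (fun w : Indiv 𝒳 => (covar w, pot0 w, pot1 w)) ⁻¹' s ×ˢ t = covar ⁻¹' s ∩ T := rfl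
  have hTint : Integrable (T.indicator fun _ => (1 : ℝ)) Q :=
    (integrable_const 1).indicator hTm
  have hπT : π * T.indicator (fun _ => (1 : ℝ)) = T.indicator π := by
    ext w
    by_cases hw : w ∈ T <;> simp [hw]
  have hπint : Integrable π Q := by
    refine (integrable_const (1 : ℝ)).mono' hπm.aestronglyMeasurable (ae_of_all _ fun w => ?_)
    rw [Real.norm_eq_abs, abs_of_nonneg (hπ0 w)]
    exact hπ1 w
  have hpull := condExp_mul_of_stronglyMeasurable_left hπσ
    (by rw [hπT]; exact hπint.indicator hTm) hTint
  -- Both sides equal π · P(T | X): the left by conditional independence, the right because π is a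
  -- function of X.
  have hae : Q[(T ∩ treat ⁻¹' {b}).indicator (fun _ => (1 : ℝ)) | sigmaX 𝒳] =ᵐ[Q]
      Q[T.indicator π | sigmaX 𝒳] := by
    rw [hπT] at hpull
    filter_upwards [hci, hpull, condExp_treat_eq hps b] with w h1 h2 h3
    rw [h1, h2, h3, Pi.mul_apply, mul_comm]
  have hreal : ∫ w in covar ⁻¹' s, (T ∩ treat ⁻¹' {b}).indicator (fun _ => (1 : ℝ)) w ∂Q =
      ∫ w in covar ⁻¹' s, T.indicator π w ∂Q := by
    rw [← setIntegral_condExp sigmaX_le ((integrable_const 1).indicator (hTm.inter hBm)) hsm,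
      ← setIntegral_condExp sigmaX_le (hπint.indicator hTm) hsm]
    exact setIntegral_congr_ae hsm' (hae.mono fun w hw _ => hw)
  rw [setIntegral_indicator (hTm.inter hBm), setIntegral_indicator hTm, setIntegral_const,
    smul_eq_mul, mul_one] at hreal
  rw [hpre, ← ofReal_integral_eq_lintegral_ofReal hπint.integrableOn (ae_of_all _ hπ0), ← hreal,
    ofReal_measureReal, Set.inter_assoc]

/-- Inverse probability weighting: on a treatment arm, functions of `(X, Y(0), Y(1))` integrate
as if weighted by the conditional probability of the arm. -/
theorem integral_arm (hign : StronglyIgnorable Q) {e : 𝒳 → ℝ} (he : Measurable e)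
    (he0 : ∀ x, 0 ≤ e x) (he1 : ∀ x, e x ≤ 1)
    (hps : propensity Q =ᵐ[Q] fun w => e (covar w)) (b : Bool)
    {F : 𝒳 × ℝ × ℝ → ℝ} (hF : Measurable F) :
    ∫ w, (if treat w = b then F (covar w, pot0 w, pot1 w) else 0) ∂Q =
      ∫ w, (if b then e (covar w) else 1 - e (covar w)) * F (covar w, pot0 w, pot1 w) ∂Q := by
  have hmeas : Measurable fun w : Indiv 𝒳 => (covar w, pot0 w, pot1 w) :=
    measurable_covar.prodMk (measurable_pot0.prodMk measurable_pot1)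
  -- Integrating against two equal measures requires no integrability of `F`.
  have h := congrArg (fun μ : Measure (𝒳 × ℝ × ℝ) => ∫ v, F v ∂μ)
    (map_withDensity_arm hign he he0 he1 hps b)
  have hπm : Measurable fun w : Indiv 𝒳 => if b then e (covar w) else 1 - e (covar w) := by
    have h' : Measurable fun w : Indiv 𝒳 => e (covar w) := he.comp measurable_covar
    cases b
    · simpa using h'.const_sub 1
    · simpa using h'
  rw [integral_map hmeas.aemeasurable hF.aestronglyMeasurable,
    integral_map hmeas.aemeasurable hF.aestronglyMeasurable,
    integral_withDensity_eq_integral_toReal_smul hπm.ennreal_ofReal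
      (ae_of_all _ fun _ => ENNReal.ofReal_lt_top),
    ← integral_indicator (measurable_treat (measurableSet_singleton b))] at h
  convert h using 1
  · refine integral_congr_ae (ae_of_all _ fun w => ?_)
    by_cases hw : treat w = b <;> simp [Set.indicator, hw]
  · refine integral_congr_ae (ae_of_all _ fun w => ?_)
    simp only [smul_eq_mul]
    rw [ENNReal.toReal_ofReal]
    cases b <;> simp [he0, he1]

end Identification

/-! ### The score and the loss in terms of arm weights -/

section ArmWeights

variable {𝒳 : Type*} {m : ℕ}

/-- The inverse probability weight of the treated. -/
def weight₁ (Φ : 𝒳 → Param m) (γ : Param m) (w : Indiv 𝒳) : ℝ :=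
  ind (treat w) * (1 + Real.exp (-inner ℝ (Φ (covar w)) γ))

/-- The inverse probability weight of the controls. -/
def weight₀ (Φ : 𝒳 → Param m) (γ : Param m) (w : Indiv 𝒳) : ℝ :=
  (1 - ind (treat w)) * (1 + Real.exp (inner ℝ (Φ (covar w)) γ))

/-- The odds of the treatment arm that was not received. -/
def oddsWeight (Φ : 𝒳 → Param m) (γ : Param m) (w : Indiv 𝒳) : ℝ :=
  ind (treat w) * Real.exp (-inner ℝ (Φ (covar w)) γ) +
    (1 - ind (treat w)) * Real.exp (inner ℝ (Φ (covar w)) γ)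

/-- The residual of the observed outcome in the outcome model of the observed arm. -/
def armResidual (Φ : 𝒳 → Param m) (β₀ β₁ : Param m) (w : Indiv 𝒳) : ℝ :=
  (obs w).2.2 - (ind (treat w) * inner ℝ (Φ (covar w)) β₁ +
    (1 - ind (treat w)) * inner ℝ (Φ (covar w)) β₀)

theorem abs_weight₁_le (Φ : 𝒳 → Param m) (γ : Param m) (w : Indiv 𝒳) :
    |weight₁ Φ γ w| ≤ ipw (psModel Φ γ) (obs w) := by
  have h : 0 ≤ weight₁ Φ γ w := by
    unfold weight₁
    cases treat w <;> simp [ind]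
    positivity
  rw [abs_of_nonneg h, ipw_psModel]
  unfold weight₁
  simp only [obs]
  cases treat w <;> simp [ind]
  positivity

theorem abs_weight₀_le (Φ : 𝒳 → Param m) (γ : Param m) (w : Indiv 𝒳) :
    |weight₀ Φ γ w| ≤ ipw (psModel Φ γ) (obs w) := by
  have h : 0 ≤ weight₀ Φ γ w := by
    unfold weight₀
    cases treat w <;> simp [ind]
    positivity
  rw [abs_of_nonneg h, ipw_psModel]
  unfold weight₀
  simp only [obs]
  cases treat w <;> simp [ind]
  positivity

theorem abs_oddsWeight_le (Φ : 𝒳 → Param m) (γ : Param m) (w : Indiv 𝒳) :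
    |oddsWeight Φ γ w| ≤ ipw (psModel Φ γ) (obs w) := by
  rw [ipw_psModel]
  unfold oddsWeight
  simp only [obs]
  cases treat w <;> simp [ind]

theorem one_add_le_one_add_pow_three {x : ℝ} (hx : 0 ≤ x) : 1 + x ≤ (1 + x) ^ 3 :=
  le_self_pow₀ (by linarith) (by norm_num)

theorem abs_inner_le_one_add (v β : Param m) : |inner ℝ v β| ≤ ‖β‖ * (1 + ‖v‖) := by
  have := abs_real_inner_le_norm v β
  nlinarith [norm_nonneg β]

theorem abs_residual_le (Φ : 𝒳 → Param m) (β : Param m) (w : Indiv 𝒳) :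
    |(obs w).2.2 - inner ℝ (Φ (covar w)) β| ≤
      (1 + ‖β‖) * (1 + |(obs w).2.2|) * (1 + ‖Φ (covar w)‖) :=
  abs_sub_inner_le (by linarith) (by linarith [norm_nonneg β])

theorem abs_residual_le' (Φ : 𝒳 → Param m) (β : Param m) (w : Indiv 𝒳) :
    |(obs w).2.2 - inner ℝ (Φ (covar w)) β| ≤
      (1 + ‖β‖) * (1 + |(obs w).2.2|) * (1 + ‖Φ (covar w)‖) ^ 3 :=
  (abs_residual_le Φ β w).trans (by
    have := norm_nonneg β
    gcongr
    exact one_add_le_one_add_pow_three (norm_nonneg _))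

theorem abs_inner_le' (Φ : 𝒳 → Param m) (β : Param m) (w : Indiv 𝒳) :
    |inner ℝ (Φ (covar w)) β| ≤ ‖β‖ * (1 + |(obs w).2.2|) * (1 + ‖Φ (covar w)‖) ^ 3 :=
  (abs_inner_le_one_add _ β).trans (by
    gcongr
    · exact le_mul_of_one_le_right (norm_nonneg _) (by linarith [abs_nonneg (obs w).2.2])
    · exact one_add_le_one_add_pow_three (norm_nonneg _))

theorem abs_armResidual_le (Φ : 𝒳 → Param m) (β₀ β₁ : Param m) (w : Indiv 𝒳) :
    |armResidual Φ β₀ β₁ w| ≤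
      (1 + ‖β₀‖ + ‖β₁‖) * (1 + |(obs w).2.2|) * (1 + ‖Φ (covar w)‖) := by
  unfold armResidual
  cases treat w
  · simp only [ind, Bool.false_eq_true, if_false, zero_mul, zero_add, sub_zero, one_mul]
    exact abs_sub_inner_le (by linarith [norm_nonneg β₁])
      (by linarith [norm_nonneg β₁, norm_nonneg β₀])
  · simp only [ind, if_true, sub_self, zero_mul, add_zero, one_mul]
    exact abs_sub_inner_le (by linarith [norm_nonneg β₀])
      (by linarith [norm_nonneg β₁, norm_nonneg β₀])

theorem exists_abs_armResidual_le (Φ : 𝒳 → Param m) (β₀ β₁ : Param m) :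
    ∃ B : ℝ, 0 ≤ B ∧ ∀ w : Indiv 𝒳, |armResidual Φ β₀ β₁ w| ≤
      B * (1 + |(obs w).2.2|) * (1 + ‖Φ (covar w)‖) :=
  ⟨1 + ‖β₀‖ + ‖β₁‖, by positivity, abs_armResidual_le Φ β₀ β₁⟩

theorem phiModel_obs (t₁ t₂ : 𝒳 → ℝ) (Φ : 𝒳 → Param m) (γ β₀ β₁ : Param m) (w : Indiv 𝒳) :
    phiModel t₁ t₂ Φ γ β₀ β₁ (obs w) = (t₁ (covar w) ^ 2 - t₂ (covar w) ^ 2) -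
      2 * ((t₁ (covar w) - t₂ (covar w)) * weight₁ Φ γ w *
          ((obs w).2.2 - inner ℝ (Φ (covar w)) β₁) +
        (t₁ (covar w) - t₂ (covar w)) * inner ℝ (Φ (covar w)) β₁ -
        (t₁ (covar w) - t₂ (covar w)) * weight₀ Φ γ w *
          ((obs w).2.2 - inner ℝ (Φ (covar w)) β₀) -
        (t₁ (covar w) - t₂ (covar w)) * inner ℝ (Φ (covar w)) β₀) := by
  rw [phiModel_eq]
  simp only [obs, weight₁, weight₀]
  ring

theorem psCoef_obs (t₁ t₂ : 𝒳 → ℝ) (Φ : 𝒳 → Param m) (γ β₀ β₁ : Param m) (w : Indiv 𝒳) :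
    psCoef t₁ t₂ Φ γ β₀ β₁ (obs w) = 2 * ((t₁ (covar w) - t₂ (covar w)) * oddsWeight Φ γ w *
      armResidual Φ β₀ β₁ w) := by
  simp only [psCoef, obs, oddsWeight, armResidual]
  cases treat w <;> simp [ind] <;> ring

/-- The ratios e/(1-e) and (1-e)/e are the odds exp(p) and exp(-p), where p = ⟨Φ, γ⟩. Compared with
`psCoef_obs`, this shows that shifting both β's along v changes the loss at the rate -`psCoef` · ⟨Φ,
v⟩. -/
theorem wlsLoss_obs (t₁ t₂ : 𝒳 → ℝ) (Φ : 𝒳 → Param m) (γ β₀ β₁ : Param m) (w : Indiv 𝒳) :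
    wlsLoss t₁ t₂ Φ γ β₀ β₁ (obs w) = (t₁ (covar w) - t₂ (covar w)) * oddsWeight Φ γ w *
      armResidual Φ β₀ β₁ w ^ 2 := by
  have h1 : (psModel Φ γ (covar w)) * (1 - psModel Φ γ (covar w))⁻¹ =
      Real.exp (inner ℝ (Φ (covar w)) γ) := by
    have := inv_one_sub_psModel Φ γ (covar w)
    have h := mul_inv_cancel₀ (sub_pos.2 (psModel_lt_one Φ γ (covar w))).ne'
    linarith
  have h2 : (1 - psModel Φ γ (covar w)) * (psModel Φ γ (covar w))⁻¹ =
      Real.exp (-inner ℝ (Φ (covar w)) γ) := by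
    have := inv_psModel Φ γ (covar w)
    have h := mul_inv_cancel₀ (psModel_pos Φ γ (covar w)).ne'
    linarith
  simp only [wlsLoss, obs, oddsWeight, armResidual, ← h1, ← h2]
  cases treat w <;> simp [ind] <;> ring

variable [MeasurableSpace 𝒳] {t₁ t₂ : 𝒳 → ℝ} {Φ : 𝒳 → Param m}

theorem measurable_psModel (hΦ : Measurable Φ) (γ : Param m) : Measurable (psModel Φ γ) := by
  unfold psModel
  fun_prop

theorem measurable_inner_const (hΦ : Measurable Φ) (v : Param m) :
    Measurable fun x => inner ℝ (Φ x) v := by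
  fun_prop

theorem measurable_inner_covar (hΦ : Measurable Φ) (v : Param m) :
    Measurable fun w : Indiv 𝒳 => inner ℝ (Φ (covar w)) v :=
  (measurable_inner_const hΦ v).comp measurable_covar

theorem measurable_diff_covar (ht₁ : Measurable t₁) (ht₂ : Measurable t₂) :
    Measurable fun w : Indiv 𝒳 => t₁ (covar w) - t₂ (covar w) :=
  (ht₁.sub ht₂).comp measurable_covar

theorem measurable_weights (hΦ : Measurable Φ) (γ : Param m) :
    Measurable (weight₁ Φ γ) ∧ Measurable (weight₀ Φ γ) := by
  have h := measurable_inner_covar hΦ γ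
  have ha : Measurable fun w : Indiv 𝒳 => ind (treat w) := measurable_ind.comp measurable_treat
  unfold weight₁ weight₀
  constructor <;> fun_prop

theorem measurable_residual (hΦ : Measurable Φ) (β : Param m) :
    Measurable fun w : Indiv 𝒳 => (obs w).2.2 - inner ℝ (Φ (covar w)) β :=
  measurable_obs.snd.snd.sub (measurable_inner_covar hΦ β)

theorem measurable_oddsWeight (hΦ : Measurable Φ) (γ : Param m) :
    Measurable (oddsWeight Φ γ) := by
  have h := measurable_inner_covar hΦ γ
  have ha : Measurable fun w : Indiv 𝒳 => ind (treat w) := measurable_ind.comp measurable_treat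
  unfold oddsWeight
  fun_prop

theorem measurable_armResidual (hΦ : Measurable Φ) (β₀ β₁ : Param m) :
    Measurable (armResidual Φ β₀ β₁) := by
  have h0 := measurable_inner_covar hΦ β₀
  have h1 := measurable_inner_covar hΦ β₁
  have ha : Measurable fun w : Indiv 𝒳 => ind (treat w) := measurable_ind.comp measurable_treat
  exact measurable_obs.snd.snd.sub ((ha.mul h1).add ((ha.const_sub 1).mul h0))

end ArmWeights

/-! ### Moment bounds and the weighted least squares normal equations -/

section NormalEquations

variable {𝒳 : Type*} [MeasurableSpace 𝒳] {m : ℕ} {Q : Measure (Indiv 𝒳)}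
  {t₁ t₂ : 𝒳 → ℝ} {Φ : 𝒳 → Param m} {γ : Param m}

/-- Square integrability of functions that grow polynomially in `‖Φ‖` relative to the inverse
probability weighted outcome. -/
theorem MomentConditions.memLp_of_le (hmom : MomentConditions Q t₁ t₂ Φ γ)
    (ht₁ : Measurable t₁) (ht₂ : Measurable t₂) (hΦ : Measurable Φ)
    {f : Indiv 𝒳 → ℝ} (hf : Measurable f) {C : ℝ}
    (h : ∀ w, |f w| ≤ C * (|t₁ (covar w) - t₂ (covar w)| * ipw (psModel Φ γ) (obs w) *
      (1 + |(obs w).2.2|) * (1 + ‖Φ (covar w)‖) ^ 3)) : MemLp f 2 Q := by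
  obtain ⟨r, hr, hint⟩ := hmom.weighted
  obtain ⟨K, hK0, hK⟩ := exists_one_add_pow_three_le (show 0 < r / 2 by positivity)
  -- The absolute value is needed since `C` carries no sign assumption.
  refine memLp_of_le_envelope hf (memLp_envelope ht₁ ht₂ hΦ hint) (C := |C| * K) fun w => ?_
  have hW := one_le_ipw Φ γ (obs w)
  refine (h w).trans ?_
  change _ ≤ |C| * K * (|t₁ (covar w) - t₂ (covar w)| * ipw (psModel Φ γ) (obs w) *
    (1 + |(obs w).2.2|) * Real.exp (r / 2 * ‖Φ (covar w)‖))
  calc _ ≤ |C| * (|t₁ (covar w) - t₂ (covar w)| * ipw (psModel Φ γ) (obs w) *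
      (1 + |(obs w).2.2|) * (K * Real.exp (r / 2 * ‖Φ (covar w)‖))) := by
        gcongr
        · exact le_abs_self C
        · exact hK _ (norm_nonneg _)
    _ = _ := by ring

theorem MomentConditions.memLp_weighted (hmom : MomentConditions Q t₁ t₂ Φ γ)
    (ht₁ : Measurable t₁) (ht₂ : Measurable t₂) (hΦ : Measurable Φ)
    {c f : Indiv 𝒳 → ℝ} (hc : Measurable c) (hf : Measurable f) {C : ℝ}
    (hcw : ∀ w, |c w| ≤ ipw (psModel Φ γ) (obs w))
    (hfw : ∀ w, |f w| ≤ C * (1 + |(obs w).2.2|) * (1 + ‖Φ (covar w)‖) ^ 3) :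
    MemLp (fun w => (t₁ (covar w) - t₂ (covar w)) * c w * f w) 2 Q := by
  refine hmom.memLp_of_le ht₁ ht₂ hΦ (((measurable_diff_covar ht₁ ht₂).mul hc).mul hf) (C := C)
    fun w => ?_
  rw [abs_mul, abs_mul]
  have hW := one_le_ipw Φ γ (obs w)
  calc _ ≤ |t₁ (covar w) - t₂ (covar w)| * ipw (psModel Φ γ) (obs w) *
        (C * (1 + |(obs w).2.2|) * (1 + ‖Φ (covar w)‖) ^ 3) := by
        gcongr
        · exact hcw w
        · exact hfw w
    _ = _ := by ring

theorem MomentConditions.memLp_weight₁ (hmom : MomentConditions Q t₁ t₂ Φ γ)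
    (ht₁ : Measurable t₁) (ht₂ : Measurable t₂) (hΦ : Measurable Φ)
    {f : Indiv 𝒳 → ℝ} (hf : Measurable f) {C : ℝ}
    (hfw : ∀ w, |f w| ≤ C * (1 + |(obs w).2.2|) * (1 + ‖Φ (covar w)‖) ^ 3) :
    MemLp (fun w => (t₁ (covar w) - t₂ (covar w)) * weight₁ Φ γ w * f w) 2 Q :=
  hmom.memLp_weighted ht₁ ht₂ hΦ (measurable_weights hΦ γ).1 hf (abs_weight₁_le Φ γ) hfw

theorem MomentConditions.memLp_weight₀ (hmom : MomentConditions Q t₁ t₂ Φ γ)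
    (ht₁ : Measurable t₁) (ht₂ : Measurable t₂) (hΦ : Measurable Φ)
    {f : Indiv 𝒳 → ℝ} (hf : Measurable f) {C : ℝ}
    (hfw : ∀ w, |f w| ≤ C * (1 + |(obs w).2.2|) * (1 + ‖Φ (covar w)‖) ^ 3) :
    MemLp (fun w => (t₁ (covar w) - t₂ (covar w)) * weight₀ Φ γ w * f w) 2 Q :=
  hmom.memLp_weighted ht₁ ht₂ hΦ (measurable_weights hΦ γ).2 hf (abs_weight₀_le Φ γ) hfw

theorem MomentConditions.memLp_diff_mul_inner (hmom : MomentConditions Q t₁ t₂ Φ γ)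
    (ht₁ : Measurable t₁) (ht₂ : Measurable t₂) (hΦ : Measurable Φ) (v : Param m) :
    MemLp (fun w : Indiv 𝒳 => (t₁ (covar w) - t₂ (covar w)) * inner ℝ (Φ (covar w)) v) 2 Q := by
  simpa using hmom.memLp_weighted ht₁ ht₂ hΦ (measurable_const (a := (1 : ℝ)))
    (measurable_inner_covar hΦ v)
    (fun w => by rw [abs_one]; exact one_le_ipw Φ γ (obs w)) (abs_inner_le' Φ v)

theorem MomentConditions.memLp_phiModel (hmom : MomentConditions Q t₁ t₂ Φ γ)
    (ht₁ : Measurable t₁) (ht₂ : Measurable t₂) (hΦ : Measurable Φ) (β₀ β₁ : Param m) :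
    MemLp (fun w => phiModel t₁ t₂ Φ γ β₀ β₁ (obs w)) 2 Q := by
  simp only [phiModel_obs]
  have hi := hmom.memLp_diff_mul_inner ht₁ ht₂ hΦ
  exact hmom.diff_sq.sub (((((hmom.memLp_weight₁ ht₁ ht₂ hΦ (measurable_residual hΦ β₁)
    (abs_residual_le' Φ β₁)).add (hi β₁)).sub (hmom.memLp_weight₀ ht₁ ht₂ hΦ
    (measurable_residual hΦ β₀) (abs_residual_le' Φ β₀))).sub (hi β₀)).const_mul 2)

variable [IsProbabilityMeasure Q]

/-- The loss is quadratic in the residual but linear in the weight. One residual stays with the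
weight and takes over the factor 1 + ‖Φ‖ of the other, which remains square integrable by the moment
condition. What is left of the second residual is a multiple of 1 + |Y|, square integrable as well,
and Hölder's inequality applies. -/
theorem MomentConditions.integrable_wlsLoss (hmom : MomentConditions Q t₁ t₂ Φ γ)
    (ht₁ : Measurable t₁) (ht₂ : Measurable t₂) (hΦ : Measurable Φ) (β₀ β₁ : Param m) :
    Integrable (fun w => wlsLoss t₁ t₂ Φ γ β₀ β₁ (obs w)) Q := by
  obtain ⟨B, hB0, hres⟩ := exists_abs_armResidual_le Φ β₀ β₁
  have hR := measurable_armResidual hΦ β₀ β₁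
  have hN : Measurable fun w : Indiv 𝒳 => 1 + ‖Φ (covar w)‖ :=
    (hΦ.comp measurable_covar).norm.const_add 1
  have h := hmom.memLp_weighted ht₁ ht₂ hΦ (measurable_oddsWeight hΦ γ)
    (f := fun w => armResidual Φ β₀ β₁ w * (1 + ‖Φ (covar w)‖)) (hR.mul hN) (C := B)
    (abs_oddsWeight_le Φ γ) fun w => by
      have hx : 1 ≤ 1 + ‖Φ (covar w)‖ := by linarith [norm_nonneg (Φ (covar w))]
      rw [abs_mul, abs_of_nonneg (zero_le_one.trans hx)]
      calc _ ≤ B * (1 + |(obs w).2.2|) * (1 + ‖Φ (covar w)‖) * (1 + ‖Φ (covar w)‖) :=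
            mul_le_mul_of_nonneg_right (hres w) (zero_le_one.trans hx)
        _ = B * (1 + |(obs w).2.2|) * (1 + ‖Φ (covar w)‖) ^ 2 := by ring
        _ ≤ _ := mul_le_mul_of_nonneg_left (pow_le_pow_right₀ hx (by norm_num)) (by positivity)
  have hY₀ : MemLp (fun w : Indiv 𝒳 => |(obs w).2.2|) 2 Q :=
    (memLp_outcome hmom.pot0_sq hmom.pot1_sq).abs
  have hY₁ : MemLp (fun w : Indiv 𝒳 => 1 + |(obs w).2.2|) 2 Q := (memLp_const (1 : ℝ)).add hY₀
  have hY : MemLp (fun w : Indiv 𝒳 => B * (1 + |(obs w).2.2|)) 2 Q := hY₁.const_mul B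
  have hint : Integrable (fun w => (t₁ (covar w) - t₂ (covar w)) * oddsWeight Φ γ w *
      (armResidual Φ β₀ β₁ w * (1 + ‖Φ (covar w)‖)) * (B * (1 + |(obs w).2.2|))) Q :=
    h.integrable_mul hY
  simp only [wlsLoss_obs]
  refine hint.mono (((measurable_diff_covar ht₁ ht₂).mul (measurable_oddsWeight hΦ γ)).mul
    (hR.pow_const 2)).aestronglyMeasurable (ae_of_all _ fun w => ?_)
  have hx : 0 ≤ 1 + ‖Φ (covar w)‖ := by positivity
  have hy : 0 ≤ 1 + |(obs w).2.2| := by positivity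
  simp only [Real.norm_eq_abs, abs_mul, abs_pow]
  rw [abs_of_nonneg hB0, abs_of_nonneg hx, abs_of_nonneg hy]
  calc _ = |t₁ (covar w) - t₂ (covar w)| * |oddsWeight Φ γ w| * |armResidual Φ β₀ β₁ w| *
        |armResidual Φ β₀ β₁ w| := by ring
    _ ≤ |t₁ (covar w) - t₂ (covar w)| * |oddsWeight Φ γ w| * |armResidual Φ β₀ β₁ w| *
        (B * (1 + |(obs w).2.2|) * (1 + ‖Φ (covar w)‖)) :=
        mul_le_mul_of_nonneg_left (hres w) (by positivity)
    _ = _ := by ring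

/-- The normal equations of weighted least squares: the gradient of `phiModel` with respect to the
propensity score parameter is centred. -/
theorem integral_psCoef (ht₁ : Measurable t₁) (ht₂ : Measurable t₂)
    (hΦ : Measurable Φ) (hmom : MomentConditions Q t₁ t₂ Φ γ) {β₀ β₁ : Param m}
    (hwls : IsWLSStationary Q t₁ t₂ Φ γ β₀ β₁) (v : Param m) :
    ∫ w, psCoef t₁ t₂ Φ γ β₀ β₁ (obs w) * inner ℝ (Φ (covar w)) v ∂Q = 0 := by
  obtain ⟨B, hB0, hres⟩ := exists_abs_armResidual_le Φ β₀ β₁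
  have hR := measurable_armResidual hΦ β₀ β₁
  have hv := measurable_inner_covar hΦ v
  have hlin : Integrable (fun w => (t₁ (covar w) - t₂ (covar w)) * oddsWeight Φ γ w *
      (armResidual Φ β₀ β₁ w * inner ℝ (Φ (covar w)) v)) Q :=
    (hmom.memLp_weighted ht₁ ht₂ hΦ (measurable_oddsWeight hΦ γ) (hR.mul hv)
      (C := B * ‖v‖) (abs_oddsWeight_le Φ γ) fun w => by
        have hx : 1 ≤ 1 + ‖Φ (covar w)‖ := by linarith [norm_nonneg (Φ (covar w))]
        rw [Pi.mul_apply, abs_mul]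
        calc _ ≤ B * (1 + |(obs w).2.2|) * (1 + ‖Φ (covar w)‖) *
              (‖v‖ * (1 + ‖Φ (covar w)‖)) :=
              mul_le_mul (hres w) (abs_inner_le_one_add _ v) (abs_nonneg _) (by positivity)
          _ = B * ‖v‖ * (1 + |(obs w).2.2|) * (1 + ‖Φ (covar w)‖) ^ 2 := by ring
          _ ≤ _ := mul_le_mul_of_nonneg_left (pow_le_pow_right₀ hx (by norm_num))
            (by positivity)).integrable one_le_two
  have hquad : Integrable (fun w => (t₁ (covar w) - t₂ (covar w)) * oddsWeight Φ γ w *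
      inner ℝ (Φ (covar w)) v ^ 2) Q :=
    (hmom.memLp_weighted ht₁ ht₂ hΦ (measurable_oddsWeight hΦ γ) (hv.pow_const 2)
      (C := ‖v‖ ^ 2) (abs_oddsWeight_le Φ γ) fun w => by
        have hx : 1 ≤ 1 + ‖Φ (covar w)‖ := by linarith [norm_nonneg (Φ (covar w))]
        have hy : 1 ≤ 1 + |(obs w).2.2| := by linarith [abs_nonneg (obs w).2.2]
        rw [abs_pow]
        calc _ ≤ (‖v‖ * (1 + ‖Φ (covar w)‖)) ^ 2 :=
              pow_le_pow_left₀ (abs_nonneg _) (abs_inner_le_one_add _ v) 2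
          _ = ‖v‖ ^ 2 * 1 * (1 + ‖Φ (covar w)‖) ^ 2 := by ring
          _ ≤ _ := mul_le_mul (mul_le_mul_of_nonneg_left hy (by positivity))
            (pow_le_pow_right₀ hx (by norm_num)) (by positivity)
            (by positivity)).integrable one_le_two
  have hloss := hmom.integrable_wlsLoss ht₁ ht₂ hΦ β₀ β₁
  obtain ⟨I₁, hI₁⟩ : ∃ I : ℝ, I = ∫ w, (t₁ (covar w) - t₂ (covar w)) * oddsWeight Φ γ w *
    (armResidual Φ β₀ β₁ w * inner ℝ (Φ (covar w)) v) ∂Q := ⟨_, rfl⟩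
  obtain ⟨I₂, hI₂⟩ : ∃ I : ℝ, I = ∫ w, (t₁ (covar w) - t₂ (covar w)) * oddsWeight Φ γ w *
    inner ℝ (Φ (covar w)) v ^ 2 ∂Q := ⟨_, rfl⟩
  -- Moving both coefficients along the same `v` shifts every residual by -s⟨Φ, v⟩ whatever the arm.
  -- The risk is then a quadratic polynomial in s with derivative -2 I₁ at 0, and stationarity
  -- forces I₁ = 0.
  have hrisk : ∀ s : ℝ, wlsRisk Q t₁ t₂ Φ γ (β₀ + s • v) (β₁ + s • v) =
      wlsRisk Q t₁ t₂ Φ γ β₀ β₁ - 2 * s * I₁ + s ^ 2 * I₂ := by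
    intro s
    have hsub : Integrable (fun w => wlsLoss t₁ t₂ Φ γ β₀ β₁ (obs w) -
        2 * s * ((t₁ (covar w) - t₂ (covar w)) * oddsWeight Φ γ w *
          (armResidual Φ β₀ β₁ w * inner ℝ (Φ (covar w)) v))) Q :=
      hloss.sub (hlin.const_mul (2 * s))
    unfold wlsRisk
    rw [hI₁, hI₂, ← integral_const_mul, ← integral_const_mul,
      ← integral_sub hloss (hlin.const_mul (2 * s)),
      ← integral_add hsub (hquad.const_mul (s ^ 2))]
    refine integral_congr_ae (ae_of_all _ fun w => ?_)
    simp only [wlsLoss_obs, armResidual, inner_add_right, inner_smul_right]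
    ring
  have hline : HasDerivAt (fun s : ℝ => (β₀ + s • v, β₁ + s • v)) (v, v) 0 := by
    have h := fun β : Param m => ((hasDerivAt_id (0 : ℝ)).smul_const v).const_add β
    simp only [one_smul, id] at h
    exact (h β₀).prodMk (h β₁)
  have hd1 := HasFDerivAt.comp_hasDerivAt (x := (0 : ℝ)) (l := fun b : Param m × Param m =>
    wlsRisk Q t₁ t₂ Φ γ b.1 b.2) (l' := (0 : Param m × Param m →L[ℝ] ℝ)) (by
      simpa [IsWLSStationary] using hwls) hline
  have hd2 : HasDerivAt (fun s : ℝ => wlsRisk Q t₁ t₂ Φ γ β₀ β₁ - 2 * s * I₁ + s ^ 2 * I₂)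
      (-(2 * I₁)) 0 := by
    have h := ((((hasDerivAt_id (0 : ℝ)).const_mul 2).mul_const I₁).const_sub
      (wlsRisk Q t₁ t₂ Φ γ β₀ β₁)).fun_add (((hasDerivAt_id (0 : ℝ)).fun_pow 2).mul_const I₂)
    simpa using h
  have hzero : I₁ = 0 := by
    have h := hd1.unique (by simpa only [Function.comp_def, hrisk] using hd2)
    simpa using h.symm
  have heq : ∀ w : Indiv 𝒳, psCoef t₁ t₂ Φ γ β₀ β₁ (obs w) * inner ℝ (Φ (covar w)) v =
      2 * ((t₁ (covar w) - t₂ (covar w)) * oddsWeight Φ γ w *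
        (armResidual Φ β₀ β₁ w * inner ℝ (Φ (covar w)) v)) := fun w => by
    rw [psCoef_obs]
    ring
  simp only [heq]
  rw [integral_const_mul, ← hI₁, hzero, mul_zero]

end NormalEquations

/-! ### Unbiasedness and centred outcome-model derivatives -/

section DoubleRobustness

variable {𝒳 : Type*} [MeasurableSpace 𝒳] [StandardBorelSpace 𝒳] {m : ℕ}
  {Q : Measure (Indiv 𝒳)} [IsProbabilityMeasure Q]
  {t₁ t₂ : 𝒳 → ℝ} {Φ : 𝒳 → Param m} {γ : Param m}

/-- The factor 1/e in the weight cancels the arm probability e supplied by `integral_arm`. -/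
theorem integral_weight₁ (hign : StronglyIgnorable Q) (ht₁ : Measurable t₁) (ht₂ : Measurable t₂)
    (hΦ : Measurable Φ)
    (hps : propensity Q =ᵐ[Q] fun w => psModel Φ γ (covar w))
    {F : 𝒳 × ℝ × ℝ → ℝ} (hF : Measurable F) :
    ∫ w, (t₁ (covar w) - t₂ (covar w)) * weight₁ Φ γ w * F (covar w, pot0 w, pot1 w) ∂Q =
      ∫ w, (t₁ (covar w) - t₂ (covar w)) * F (covar w, pot0 w, pot1 w) ∂Q := by
  have hm : Measurable fun v : 𝒳 × ℝ × ℝ => (psModel Φ γ v.1)⁻¹ * ((t₁ v.1 - t₂ v.1) * F v) :=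
    ((measurable_psModel hΦ γ).comp measurable_fst).inv.mul
      (((ht₁.sub ht₂).comp measurable_fst).mul hF)
  have h := integral_arm hign (measurable_psModel hΦ γ) (fun x => (psModel_pos Φ γ x).le)
    (fun x => (psModel_lt_one Φ γ x).le) hps true hm
  convert h using 1
  · refine integral_congr_ae (ae_of_all _ fun w => ?_)
    simp only [inv_psModel, weight₁]
    cases treat w <;> simp [ind]
    ring
  · refine integral_congr_ae (ae_of_all _ fun w => ?_)
    simp only [if_true]
    rw [mul_inv_cancel_left₀ (psModel_pos Φ γ _).ne']

theorem integral_weight₀ (hign : StronglyIgnorable Q) (ht₁ : Measurable t₁) (ht₂ : Measurable t₂)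
    (hΦ : Measurable Φ)
    (hps : propensity Q =ᵐ[Q] fun w => psModel Φ γ (covar w))
    {F : 𝒳 × ℝ × ℝ → ℝ} (hF : Measurable F) :
    ∫ w, (t₁ (covar w) - t₂ (covar w)) * weight₀ Φ γ w * F (covar w, pot0 w, pot1 w) ∂Q =
      ∫ w, (t₁ (covar w) - t₂ (covar w)) * F (covar w, pot0 w, pot1 w) ∂Q := by
  have hm : Measurable fun v : 𝒳 × ℝ × ℝ => (1 - psModel Φ γ v.1)⁻¹ * ((t₁ v.1 - t₂ v.1) * F v) :=
    (((measurable_psModel hΦ γ).comp measurable_fst).const_sub 1).inv.mul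
      (((ht₁.sub ht₂).comp measurable_fst).mul hF)
  have h := integral_arm hign (measurable_psModel hΦ γ) (fun x => (psModel_pos Φ γ x).le)
    (fun x => (psModel_lt_one Φ γ x).le) hps false hm
  convert h using 1
  · refine integral_congr_ae (ae_of_all _ fun w => ?_)
    simp only [inv_one_sub_psModel, weight₀]
    cases treat w <;> simp [ind]
    ring
  · refine integral_congr_ae (ae_of_all _ fun w => ?_)
    simp only [Bool.false_eq_true, if_false]
    rw [mul_inv_cancel_left₀ (sub_pos.2 (psModel_lt_one Φ γ _)).ne']

/-- The coefficient is 2 (t₁ - t₂) (`weight₁` - 1), and the weight integrates like 1 against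
functions of X. -/
theorem integral_orCoef₁ (hign : StronglyIgnorable Q) (ht₁ : Measurable t₁) (ht₂ : Measurable t₂)
    (hΦ : Measurable Φ) (hps : propensity Q =ᵐ[Q] fun w => psModel Φ γ (covar w))
    (hmom : MomentConditions Q t₁ t₂ Φ γ) (v : Param m) :
    ∫ w, orCoef₁ t₁ t₂ Φ γ (obs w) * inner ℝ (Φ (covar w)) v ∂Q = 0 := by
  have hF : Measurable fun p : 𝒳 × ℝ × ℝ => inner ℝ (Φ p.1) v :=
    (measurable_inner_const hΦ v).comp measurable_fst
  have h := integral_weight₁ hign ht₁ ht₂ hΦ hps hF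
  have hi1 := (hmom.memLp_weight₁ ht₁ ht₂ hΦ (measurable_inner_covar hΦ v)
    (abs_inner_le' Φ v)).integrable one_le_two
  have hi2 := (hmom.memLp_diff_mul_inner ht₁ ht₂ hΦ v).integrable one_le_two
  have heq : ∀ w : Indiv 𝒳, orCoef₁ t₁ t₂ Φ γ (obs w) * inner ℝ (Φ (covar w)) v =
      2 * ((t₁ (covar w) - t₂ (covar w)) * weight₁ Φ γ w * inner ℝ (Φ (covar w)) v -
        (t₁ (covar w) - t₂ (covar w)) * inner ℝ (Φ (covar w)) v) := fun w => by
    simp only [orCoef₁, obs, weight₁]; ring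
  simp only [heq]
  rw [integral_const_mul, integral_sub hi1 hi2, h, sub_self, mul_zero]

/-- The coefficient is 2 (t₁ - t₂) (1 - `weight₀`), so the argument of the treated arm applies with
the opposite sign. -/
theorem integral_orCoef₀ (hign : StronglyIgnorable Q) (ht₁ : Measurable t₁) (ht₂ : Measurable t₂)
    (hΦ : Measurable Φ) (hps : propensity Q =ᵐ[Q] fun w => psModel Φ γ (covar w))
    (hmom : MomentConditions Q t₁ t₂ Φ γ) (v : Param m) :
    ∫ w, orCoef₀ t₁ t₂ Φ γ (obs w) * inner ℝ (Φ (covar w)) v ∂Q = 0 := by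
  have hF : Measurable fun p : 𝒳 × ℝ × ℝ => inner ℝ (Φ p.1) v :=
    (measurable_inner_const hΦ v).comp measurable_fst
  have h := integral_weight₀ hign ht₁ ht₂ hΦ hps hF
  have hi1 := (hmom.memLp_weight₀ ht₁ ht₂ hΦ (measurable_inner_covar hΦ v)
    (abs_inner_le' Φ v)).integrable one_le_two
  have hi2 := (hmom.memLp_diff_mul_inner ht₁ ht₂ hΦ v).integrable one_le_two
  have heq : ∀ w : Indiv 𝒳, orCoef₀ t₁ t₂ Φ γ (obs w) * inner ℝ (Φ (covar w)) v =
      2 * ((t₁ (covar w) - t₂ (covar w)) * inner ℝ (Φ (covar w)) v -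
        (t₁ (covar w) - t₂ (covar w)) * weight₀ Φ γ w * inner ℝ (Φ (covar w)) v) := fun w => by
    simp only [orCoef₀, obs, weight₀]; ring
  simp only [heq]
  rw [integral_const_mul, integral_sub hi2 hi1, h, sub_self, mul_zero]

/-- The estimating function is unbiased for the relative error when the propensity score is
correctly specified, whatever the outcome models. -/
theorem integral_phiModel (hign : StronglyIgnorable Q) (ht₁ : Measurable t₁) (ht₂ : Measurable t₂)
    (hΦ : Measurable Φ) (hps : propensity Q =ᵐ[Q] fun w => psModel Φ γ (covar w))
    (hmom : MomentConditions Q t₁ t₂ Φ γ) (β₀ β₁ : Param m) :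
    ∫ w, phiModel t₁ t₂ Φ γ β₀ β₁ (obs w) ∂Q = relErr Q t₁ t₂ := by
  have hd2 := (hmom.est1_sq.sub hmom.est2_sq)
  have hi := fun β => (hmom.memLp_diff_mul_inner ht₁ ht₂ hΦ β).integrable one_le_two
  have hw1 := (hmom.memLp_weight₁ ht₁ ht₂ hΦ (measurable_residual hΦ β₁)
    (abs_residual_le' Φ β₁)).integrable one_le_two
  have hw0 := (hmom.memLp_weight₀ ht₁ ht₂ hΦ (measurable_residual hΦ β₀)
    (abs_residual_le' Φ β₀)).integrable one_le_two
  have hy1 : Integrable (fun w : Indiv 𝒳 => (t₁ (covar w) - t₂ (covar w)) * pot1 w) Q :=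
    hd2.integrable_mul hmom.pot1_sq
  have hy0 : Integrable (fun w : Indiv 𝒳 => (t₁ (covar w) - t₂ (covar w)) * pot0 w) Q :=
    hd2.integrable_mul hmom.pot0_sq
  have hsq := hmom.diff_sq.integrable one_le_two
  have h1 : ∫ w, (t₁ (covar w) - t₂ (covar w)) * weight₁ Φ γ w *
      ((obs w).2.2 - inner ℝ (Φ (covar w)) β₁) ∂Q =
      ∫ w, (t₁ (covar w) - t₂ (covar w)) * pot1 w ∂Q -
        ∫ w, (t₁ (covar w) - t₂ (covar w)) * inner ℝ (Φ (covar w)) β₁ ∂Q := by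
    have hF : Measurable fun p : 𝒳 × ℝ × ℝ => p.2.2 - inner ℝ (Φ p.1) β₁ :=
      measurable_snd.snd.sub ((measurable_inner_const hΦ β₁).comp measurable_fst)
    rw [← integral_sub hy1 (hi β₁)]
    convert integral_weight₁ hign ht₁ ht₂ hΦ hps hF using 1
    · refine integral_congr_ae (ae_of_all _ fun w => ?_)
      simp only [obs, weight₁]
      cases treat w <;> simp [ind]
    · simp only [mul_sub]
  have h0 : ∫ w, (t₁ (covar w) - t₂ (covar w)) * weight₀ Φ γ w *
      ((obs w).2.2 - inner ℝ (Φ (covar w)) β₀) ∂Q =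
      ∫ w, (t₁ (covar w) - t₂ (covar w)) * pot0 w ∂Q -
        ∫ w, (t₁ (covar w) - t₂ (covar w)) * inner ℝ (Φ (covar w)) β₀ ∂Q := by
    have hF : Measurable fun p : 𝒳 × ℝ × ℝ => p.2.1 - inner ℝ (Φ p.1) β₀ :=
      measurable_snd.fst.sub ((measurable_inner_const hΦ β₀).comp measurable_fst)
    rw [← integral_sub hy0 (hi β₀)]
    convert integral_weight₀ hign ht₁ ht₂ hΦ hps hF using 1
    · refine integral_congr_ae (ae_of_all _ fun w => ?_)
      simp only [obs, weight₀]
      cases treat w <;> simp [ind]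
    · simp only [mul_sub]
  have hcate : MemLp (cate Q) 2 Q := (hmom.pot1_sq.sub hmom.pot0_sq).condExp one_le_two
  have hτ : Integrable (fun w : Indiv 𝒳 => (t₁ (covar w) - t₂ (covar w)) * cate Q w) Q :=
    hd2.integrable_mul hcate
  -- The tower property: t₁ - t₂ is a function of X and can be moved inside the conditional
  -- expectation.
  have hpull : ∫ w, (t₁ (covar w) - t₂ (covar w)) * cate Q w ∂Q =
      ∫ w, (t₁ (covar w) - t₂ (covar w)) * pot1 w ∂Q -
        ∫ w, (t₁ (covar w) - t₂ (covar w)) * pot0 w ∂Q := by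
    have hσ : StronglyMeasurable[sigmaX 𝒳] fun w : Indiv 𝒳 => t₁ (covar w) - t₂ (covar w) :=
      ((ht₁.sub ht₂).comp (comap_measurable covar)).stronglyMeasurable
    have h := condExp_mul_of_stronglyMeasurable_left (μ := Q) hσ
      (hd2.integrable_mul (hmom.pot1_sq.sub hmom.pot0_sq))
      ((hmom.pot1_sq.sub hmom.pot0_sq).integrable one_le_two)
    rw [← integral_sub hy1 hy0]
    have h' := integral_congr_ae h
    rw [integral_condExp sigmaX_le] at h'
    simp only [Pi.mul_apply, Pi.sub_apply, mul_sub] at h'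
    exact h'.symm
  -- The terms τ² of the two squared errors cancel, leaving an expression linear in τ.
  have hrel : relErr Q t₁ t₂ = ∫ w, (t₁ (covar w) ^ 2 - t₂ (covar w) ^ 2) ∂Q -
      2 * ∫ w, (t₁ (covar w) - t₂ (covar w)) * cate Q w ∂Q := by
    unfold relErr absErr
    refine ((integral_sub (hmom.est1_sq.sub hcate).integrable_sq
      (hmom.est2_sq.sub hcate).integrable_sq).symm).trans ?_
    rw [← integral_const_mul, ← integral_sub hsq (hτ.const_mul 2)]
    refine integral_congr_ae (ae_of_all _ fun w => ?_)
    simp only [Pi.sub_apply]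
    ring
  simp only [phiModel_obs]
  have ha : Integrable (fun w => (t₁ (covar w) - t₂ (covar w)) * weight₁ Φ γ w *
      ((obs w).2.2 - inner ℝ (Φ (covar w)) β₁) +
      (t₁ (covar w) - t₂ (covar w)) * inner ℝ (Φ (covar w)) β₁) Q := hw1.add (hi β₁)
  have hb : Integrable (fun w => (t₁ (covar w) - t₂ (covar w)) * weight₁ Φ γ w *
      ((obs w).2.2 - inner ℝ (Φ (covar w)) β₁) +
      (t₁ (covar w) - t₂ (covar w)) * inner ℝ (Φ (covar w)) β₁ -
      (t₁ (covar w) - t₂ (covar w)) * weight₀ Φ γ w *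
        ((obs w).2.2 - inner ℝ (Φ (covar w)) β₀)) Q := ha.sub hw0
  have hc : Integrable (fun w => (t₁ (covar w) - t₂ (covar w)) * weight₁ Φ γ w *
      ((obs w).2.2 - inner ℝ (Φ (covar w)) β₁) +
      (t₁ (covar w) - t₂ (covar w)) * inner ℝ (Φ (covar w)) β₁ -
      (t₁ (covar w) - t₂ (covar w)) * weight₀ Φ γ w *
        ((obs w).2.2 - inner ℝ (Φ (covar w)) β₀) -
      (t₁ (covar w) - t₂ (covar w)) * inner ℝ (Φ (covar w)) β₀) Q := hb.sub (hi β₀)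
  rw [integral_sub hsq (hc.const_mul 2), integral_const_mul,
    integral_sub hb (hi β₀), integral_sub ha hw0, integral_add hw1 (hi β₁), h1, h0, hrel, hpull]
  ring

end DoubleRobustness

/-! ### Deterministic perturbation bounds for averages -/

section Averages

theorem abs_average_sub_le {n : ℕ} {a b d : ℕ → ℝ} (h : ∀ i, |a i - b i| ≤ d i) :
    |(1 / (n : ℝ)) * ∑ i ∈ Finset.range n, a i - (1 / (n : ℝ)) * ∑ i ∈ Finset.range n, b i| ≤
      (1 / (n : ℝ)) * ∑ i ∈ Finset.range n, d i := by
  rw [← mul_sub, ← Finset.sum_sub_distrib, abs_mul,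
    abs_of_nonneg (show (0 : ℝ) ≤ 1 / n by positivity)]
  gcongr
  exact (Finset.abs_sum_le_sum_abs _ _).trans (Finset.sum_le_sum fun i _ => h i)

theorem average_sq_sub_average {n : ℕ} (hn : n ≠ 0) (a : ℕ → ℝ) :
    (1 / (n : ℝ)) * ∑ i ∈ Finset.range n,
      (a i - (1 / (n : ℝ)) * ∑ i ∈ Finset.range n, a i) ^ 2 =
      (1 / (n : ℝ)) * ∑ i ∈ Finset.range n, a i ^ 2 -
        ((1 / (n : ℝ)) * ∑ i ∈ Finset.range n, a i) ^ 2 := by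
  have hn' : (n : ℝ) ≠ 0 := by exact_mod_cast hn
  set M := (1 / (n : ℝ)) * ∑ i ∈ Finset.range n, a i with hM
  have hS : ∑ i ∈ Finset.range n, a i = n * M := by rw [hM]; field_simp
  have : ∀ i, (a i - M) ^ 2 = a i ^ 2 - 2 * M * a i + M ^ 2 := fun i => by ring
  simp only [this, Finset.sum_add_distrib, Finset.sum_sub_distrib, ← Finset.mul_sum, hS,
    Finset.sum_const, Finset.card_range, nsmul_eq_mul]
  field_simp
  ring

/-- Averages of perturbed terms and of their squares, when the perturbations are at most `c` times
an envelope. -/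
theorem abs_average_perturbed_le {n : ℕ} (hn : n ≠ 0) {a b g : ℕ → ℝ} {c : ℝ} (hc : 0 ≤ c)
    (h : ∀ i, |a i - b i| ≤ c * g i) :
    |(1 / (n : ℝ)) * ∑ i ∈ Finset.range n, a i - (1 / (n : ℝ)) * ∑ i ∈ Finset.range n, b i| ≤
        c * (1 + (1 / (n : ℝ)) * ∑ i ∈ Finset.range n, g i ^ 2) ∧
      |(1 / (n : ℝ)) * ∑ i ∈ Finset.range n, a i ^ 2 -
          (1 / (n : ℝ)) * ∑ i ∈ Finset.range n, b i ^ 2| ≤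
        c * ((1 / (n : ℝ)) * ∑ i ∈ Finset.range n, b i ^ 2) +
          (c + c ^ 2) * ((1 / (n : ℝ)) * ∑ i ∈ Finset.range n, g i ^ 2) := by
  have hn' : (n : ℝ) ≠ 0 := by exact_mod_cast hn
  constructor
  · refine (abs_average_sub_le (d := fun i => c * (1 + g i ^ 2)) fun i => ?_).trans_eq ?_
    · refine (h i).trans ?_
      gcongr
      nlinarith [sq_nonneg (g i - 1)]
    · rw [← Finset.mul_sum, Finset.sum_add_distrib]
      simp only [Finset.sum_const, Finset.card_range, nsmul_eq_mul]
      field_simp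
  · refine (abs_average_sub_le (d := fun i => c * b i ^ 2 + (c + c ^ 2) * g i ^ 2)
      fun i => ?_).trans_eq ?_
    · have h1 : a i ^ 2 - b i ^ 2 = 2 * b i * (a i - b i) + (a i - b i) ^ 2 := by ring
      have h2 : (a i - b i) ^ 2 ≤ (c * g i) ^ 2 := by
        rw [← sq_abs (a i - b i)]
        exact pow_le_pow_left₀ (abs_nonneg _) (h i) 2
      have h3 : |2 * b i * (a i - b i)| ≤ 2 * |b i| * (c * g i) := by
        rw [abs_mul, abs_mul, abs_two]
        exact mul_le_mul_of_nonneg_left (h i) (by positivity)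
      -- Splitting the cross term this way leaves only averages of `b²` and `g²`, which the law of
      -- large numbers controls.
      have h4 : 2 * |b i| * (c * g i) ≤ c * (b i ^ 2 + g i ^ 2) := by
        have := mul_nonneg hc (sq_nonneg (|b i| - g i))
        rw [← sq_abs (b i)]
        linarith
      rw [h1]
      refine (abs_add_le _ _).trans ?_
      rw [abs_of_nonneg (sq_nonneg (a i - b i))]
      linarith
    · rw [Finset.sum_add_distrib, ← Finset.mul_sum, ← Finset.mul_sum]
      ring

end Averages

/-! ### Nuisance error and consistency of the variance estimator -/

section Asymptotics

variable {Ω : Type*} [MeasurableSpace Ω] {P : Measure Ω}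

/-- Coordinatewise convergence in probability to a constant vector. -/
theorem tendstoInMeasure_pi {ι : Type*} [Fintype ι] {X : ℕ → Ω → ι → ℝ} {c : ι → ℝ}
    (h : ∀ j, TendstoInMeasure P (fun n ω => X n ω j) atTop (fun _ => c j)) :
    TendstoInMeasure P X atTop (fun _ => c) := by
  intro ε hε
  have hsum := tendsto_finsetSum (Finset.univ : Finset ι) fun j _ => h j ε hε
  rw [Finset.sum_const_zero] at hsum
  refine tendsto_of_tendsto_of_tendsto_of_le_of_le tendsto_const_nhds hsum (fun _ => zero_le)
    (fun n => ?_)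
  refine (measure_mono fun ω hω => ?_).trans (measure_iUnion_fintype_le P
    fun j => {ω | ε ≤ edist (X n ω j) (c j)})
  rw [Set.mem_ofPred_eq, edist_pi_def, Finset.le_sup_iff hε] at hω
  obtain ⟨j, -, hj⟩ := hω
  exact Set.mem_iUnion.2 ⟨j, hj⟩

variable {m : ℕ}

/-- The joint estimation error of the nuisance parameters. -/
def nuisanceError (γ β₀ β₁ g b₀ b₁ : Param m) : ℝ := ‖g - γ‖ + ‖b₀ - β₀‖ + ‖b₁ - β₁‖

theorem nuisanceError_nonneg (γ β₀ β₁ g b₀ b₁ : Param m) :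
    0 ≤ nuisanceError γ β₀ β₁ g b₀ b₁ := by
  unfold nuisanceError; positivity

theorem norm_le_nuisanceError (γ β₀ β₁ g b₀ b₁ : Param m) :
    ‖g - γ‖ ≤ nuisanceError γ β₀ β₁ g b₀ b₁ ∧ ‖b₀ - β₀‖ ≤ nuisanceError γ β₀ β₁ g b₀ b₁ ∧
      ‖b₁ - β₁‖ ≤ nuisanceError γ β₀ β₁ g b₀ b₁ := by
  have h1 := norm_nonneg (g - γ)
  have h2 := norm_nonneg (b₀ - β₀)
  have h3 := norm_nonneg (b₁ - β₁)
  unfold nuisanceError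
  refine ⟨?_, ?_, ?_⟩ <;> linarith

theorem tendstoInMeasure_nuisanceError [IsFiniteMeasure P] {γhat β₀hat β₁hat : ℕ → Ω → Param m}
    (hγmeas : ∀ n, Measurable (γhat n)) (hβ₀meas : ∀ n, Measurable (β₀hat n))
    (hβ₁meas : ∀ n, Measurable (β₁hat n)) {γ β₀ β₁ : Param m}
    (hγ : FasterThanQuarter P γhat γ) (hβ₀ : FasterThanQuarter P β₀hat β₀)
    (hβ₁ : FasterThanQuarter P β₁hat β₁) :
    TendstoInMeasure P (fun (n : ℕ) ω => (n : ℝ) ^ (1 / 4 : ℝ) *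
      nuisanceError γ β₀ β₁ (γhat n ω) (β₀hat n ω) (β₁hat n ω)) atTop (fun _ => 0) := by
  have hmeas : ∀ n : ℕ, Measurable fun ω => (n : ℝ) ^ (1 / 4 : ℝ) *
      nuisanceError γ β₀ β₁ (γhat n ω) (β₀hat n ω) (β₁hat n ω) := fun n => by
    have h1 := hγmeas n
    have h2 := hβ₀meas n
    have h3 := hβ₁meas n
    unfold nuisanceError
    fun_prop
  refine tendstoInMeasure_of_pathwise (tendstoInMeasure_prodMk hγ (tendstoInMeasure_prodMk hβ₀ hβ₁))
    (fun n => (hmeas n).aestronglyMeasurable) fun ω ns _ h => ?_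
  have h1 := ((continuous_fst.tendsto _).comp h).norm
  have h2 := (((continuous_fst.comp continuous_snd).tendsto _).comp h).norm
  have h3 := (((continuous_snd.comp continuous_snd).tendsto _).comp h).norm
  have hs := (h1.add h2).add h3
  simp only [Function.comp_def, norm_smul, norm_zero, add_zero] at hs
  refine hs.congr fun k => ?_
  rw [nuisanceError, Real.norm_of_nonneg (by positivity)]
  ring

/-- Along a path on which the scaled nuisance error vanishes, so does the unscaled one. -/
theorem tendsto_zero_of_scaled {ns : ℕ → ℕ} (hns : Tendsto ns atTop atTop) {ρ : ℕ → ℝ}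
    (hρ : ∀ k, 0 ≤ ρ k) (h : Tendsto (fun k => (ns k : ℝ) ^ (1 / 4 : ℝ) * ρ k) atTop (𝓝 0)) :
    Tendsto ρ atTop (𝓝 0) := by
  refine tendsto_of_tendsto_of_tendsto_of_le_of_le' tendsto_const_nhds h
    (Eventually.of_forall hρ) ?_
  filter_upwards [hns.eventually_ge_atTop 1] with k hk
  have : (1 : ℝ) ≤ (ns k : ℝ) ^ (1 / 4 : ℝ) :=
    Real.one_le_rpow (by exact_mod_cast hk) (by norm_num)
  exact le_mul_of_one_le_left (hρ k) this

variable {𝒳 : Type*} [MeasurableSpace 𝒳] {Q : Measure (Indiv 𝒳)}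
  {t₁ t₂ : 𝒳 → ℝ} {Φ : 𝒳 → Param m} {W : ℕ → Ω → Indiv 𝒳} {γhat β₀hat β₁hat : ℕ → Ω → Param m}

theorem measurable_deltaHat (hWmeas : ∀ i, Measurable (W i)) (ht₁ : Measurable t₁)
    (ht₂ : Measurable t₂) (hΦ : Measurable Φ) {g b₀ b₁ : Ω → Param m} (hg : Measurable g)
    (hb₀ : Measurable b₀) (hb₁ : Measurable b₁) (n : ℕ) :
    Measurable fun ω => deltaHat t₁ t₂ Φ (g ω) (b₀ ω) (b₁ ω) n (fun i => W i ω) :=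
  (Finset.measurable_sum _ fun i _ => measurable_phiModel_joint ht₁ ht₂ hΦ hg hb₀ hb₁
    (measurable_obs.comp (hWmeas i))).const_mul _

theorem measurable_sigmaHatSq (hWmeas : ∀ i, Measurable (W i)) (ht₁ : Measurable t₁)
    (ht₂ : Measurable t₂) (hΦ : Measurable Φ) {g b₀ b₁ : Ω → Param m} (hg : Measurable g)
    (hb₀ : Measurable b₀) (hb₁ : Measurable b₁) (n : ℕ) :
    Measurable fun ω => sigmaHatSq t₁ t₂ Φ (g ω) (b₀ ω) (b₁ ω) n (fun i => W i ω) :=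
  (Finset.measurable_sum _ fun i _ => ((measurable_phiModel_joint ht₁ ht₂ hΦ hg hb₀ hb₁
    (measurable_obs.comp (hWmeas i))).sub
    (measurable_deltaHat hWmeas ht₁ ht₂ hΦ hg hb₀ hb₁ n)).pow_const 2).const_mul _

variable [IsProbabilityMeasure P] [IsProbabilityMeasure Q] {γ β₀ β₁ : Param m}

/-- Consistency of the variance estimator. -/
theorem tendstoInMeasure_sigmaHatSq (hWmeas : ∀ i, Measurable (W i))
    (hWindep : iIndepFun W P) (hWlaw : ∀ i, P.map (W i) = Q)
    (ht₁ : Measurable t₁) (ht₂ : Measurable t₂) (hΦ : Measurable Φ)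
    (hγmeas : ∀ n, Measurable (γhat n)) (hβ₀meas : ∀ n, Measurable (β₀hat n))
    (hβ₁meas : ∀ n, Measurable (β₁hat n))
    (hγ : FasterThanQuarter P γhat γ) (hβ₀ : FasterThanQuarter P β₀hat β₀)
    (hβ₁ : FasterThanQuarter P β₁hat β₁) (hmom : MomentConditions Q t₁ t₂ Φ γ) :
    TendstoInMeasure P
      (fun (n : ℕ) (ω : Ω) =>
        sigmaHatSq t₁ t₂ Φ (γhat n ω) (β₀hat n ω) (β₁hat n ω) n (fun i => W i ω))
      atTop (fun _ => sigmaSq Q t₁ t₂ Φ γ β₀ β₁) := by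
  obtain ⟨r, hr, hint⟩ := hmom.weighted
  have henv := memLp_envelope ht₁ ht₂ hΦ hint
  have hphi := hmom.memLp_phiModel ht₁ ht₂ hΦ β₀ β₁
  have hphim : Measurable fun w : Indiv 𝒳 => phiModel t₁ t₂ Φ γ β₀ β₁ (obs w) :=
    (measurable_phiModel ht₁ ht₂ hΦ γ β₀ β₁).comp measurable_obs
  have henvm : Measurable fun w : Indiv 𝒳 => envelope t₁ t₂ Φ γ r (obs w) :=
    (measurable_coefs ht₁ ht₂ hΦ γ 0 0 r).2.2.2.comp measurable_obs
  obtain ⟨C, hC, hlip⟩ := exists_phiModel_lipschitz t₁ t₂ Φ γ β₀ β₁ hr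
  have hX := tendstoInMeasure_prodMk
    (tendstoInMeasure_nuisanceError hγmeas hβ₀meas hβ₁meas hγ hβ₀ hβ₁)
    (tendstoInMeasure_prodMk
      (tendstoInMeasure_average hWmeas hWindep hWlaw hphim (hphi.integrable one_le_two))
      (tendstoInMeasure_prodMk
        (tendstoInMeasure_average hWmeas hWindep hWlaw (hphim.pow_const 2) hphi.integrable_sq)
        (tendstoInMeasure_average hWmeas hWindep hWlaw (henvm.pow_const 2) henv.integrable_sq)))
  refine tendstoInMeasure_of_pathwise hX (fun n => (measurable_sigmaHatSq hWmeas ht₁ ht₂ hΦ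
    (hγmeas n) (hβ₀meas n) (hβ₁meas n) n).aestronglyMeasurable) fun ω ns hns h => ?_
  have hκ := (continuous_fst.tendsto _).comp h
  have hM1 := ((continuous_fst.comp continuous_snd).tendsto _).comp h
  have hM2 := ((continuous_fst.comp (continuous_snd.comp continuous_snd)).tendsto _).comp h
  have hG := ((continuous_snd.comp (continuous_snd.comp continuous_snd)).tendsto _).comp h
  simp only [Function.comp_def] at hκ hM1 hM2 hG
  set ρ : ℕ → ℝ := fun k => nuisanceError γ β₀ β₁ (γhat (ns k) ω) (β₀hat (ns k) ω)
    (β₁hat (ns k) ω) with hρdef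
  have hρ0 : ∀ k, 0 ≤ ρ k := fun k => nuisanceError_nonneg _ _ _ _ _ _
  -- For the variance only the convergence of the nuisance parameters matters, not its rate.
  have hρ := tendsto_zero_of_scaled hns hρ0 hκ
  have hev : ∀ᶠ k in atTop, ns k ≠ 0 ∧ ∀ i,
      |phiModel t₁ t₂ Φ (γhat (ns k) ω) (β₀hat (ns k) ω) (β₁hat (ns k) ω) (obs (W i ω)) -
        phiModel t₁ t₂ Φ γ β₀ β₁ (obs (W i ω))| ≤
        C * ρ k * envelope t₁ t₂ Φ γ r (obs (W i ω)) := by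
    filter_upwards [hns.eventually_ge_atTop 1,
      hρ.eventually (gt_mem_nhds (show 0 < r / 4 by positivity)),
      hρ.eventually (gt_mem_nhds zero_lt_one)] with k hk h1 h2
    refine ⟨by omega, fun i => ?_⟩
    obtain ⟨hn1, hn2, hn3⟩ := norm_le_nuisanceError γ β₀ β₁ (γhat (ns k) ω) (β₀hat (ns k) ω)
      (β₁hat (ns k) ω)
    have := hlip (obs (W i ω)) _ _ _ _ hn1 hn2 hn3 h1.le h2.le
    simpa only [add_sub_cancel] using this
  have hCρ : Tendsto (fun k => C * ρ k) atTop (𝓝 0) := by simpa using hρ.const_mul C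
  have hA1 : Tendsto (fun k => deltaHat t₁ t₂ Φ (γhat (ns k) ω) (β₀hat (ns k) ω)
      (β₁hat (ns k) ω) (ns k) (fun i => W i ω)) atTop
      (𝓝 (∫ w, phiModel t₁ t₂ Φ γ β₀ β₁ (obs w) ∂Q)) := by
    refine tendsto_of_tendsto_of_dist hM1 ?_
    have hb := hCρ.mul (hG.const_add 1)
    rw [zero_mul] at hb
    refine squeeze_zero' (Eventually.of_forall fun _ => dist_nonneg) ?_ hb
    filter_upwards [hev] with k ⟨hk, hk'⟩
    rw [dist_comm, Real.dist_eq]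
    exact (abs_average_perturbed_le hk (mul_nonneg hC.le (hρ0 k)) hk').1
  have hA2 : Tendsto (fun k => (1 / (ns k : ℝ)) * ∑ i ∈ Finset.range (ns k),
      phiModel t₁ t₂ Φ (γhat (ns k) ω) (β₀hat (ns k) ω) (β₁hat (ns k) ω) (obs (W i ω)) ^ 2) atTop
      (𝓝 (∫ w, phiModel t₁ t₂ Φ γ β₀ β₁ (obs w) ^ 2 ∂Q)) := by
    refine tendsto_of_tendsto_of_dist hM2 ?_
    have hb := (hCρ.mul hM2).add ((hCρ.add (hCρ.pow 2)).mul hG)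
    simp only [zero_mul, ne_eq, OfNat.ofNat_ne_zero, not_false_eq_true, zero_pow,
      add_zero] at hb
    refine squeeze_zero' (Eventually.of_forall fun _ => dist_nonneg) ?_ hb
    filter_upwards [hev] with k ⟨hk, hk'⟩
    rw [dist_comm, Real.dist_eq]
    exact (abs_average_perturbed_le hk (mul_nonneg hC.le (hρ0 k)) hk').2
  have hvar : sigmaSq Q t₁ t₂ Φ γ β₀ β₁ = ∫ w, phiModel t₁ t₂ Φ γ β₀ β₁ (obs w) ^ 2 ∂Q -
      (∫ w, phiModel t₁ t₂ Φ γ β₀ β₁ (obs w) ∂Q) ^ 2 := by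
    rw [sigmaSq, variance_eq_sub hphi]
    rfl
  rw [hvar]
  refine (hA2.sub (hA1.pow 2)).congr' ?_
  filter_upwards [hev] with k ⟨hk, _⟩
  exact (average_sq_sub_average hk _).symm

end Asymptotics

/-! ### The √n-scaled linear expansion -/

section Linearization

variable {m : ℕ}

/-- The `n^{-3/4}`-scaled coordinate sums of the random vectors `c i • x i`. -/
def scaledSum (n : ℕ) (c : ℕ → ℝ) (x : ℕ → Param m) (j : Fin m) : ℝ :=
  ((n : ℝ) ^ (3 / 4 : ℝ))⁻¹ *
    ∑ i ∈ Finset.range n, c i * inner ℝ (x i) (EuclideanSpace.single j 1)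

/-- Since √n / n = n^{-3/4} · n^{1/4}, the scale divides between the coordinate sums and the
parameter error. The sums are free of `u`, so later `u` may be random and depend on the sample. -/
theorem sqrt_mul_average_inner_eq {n : ℕ} (hn : n ≠ 0) (c : ℕ → ℝ) (x : ℕ → Param m)
    (u : Param m) :
    √n * ((1 / (n : ℝ)) * ∑ i ∈ Finset.range n, c i * inner ℝ (x i) u) =
      ∑ j, scaledSum n c x j * ((n : ℝ) ^ (1 / 4 : ℝ) * u j) := by
  have hn' : (0 : ℝ) < n := by exact_mod_cast Nat.pos_of_ne_zero hn
  have hu : ∀ i, inner ℝ (x i) u = ∑ j, inner ℝ (x i) (EuclideanSpace.single j 1) * u j := by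
    intro i
    rw [PiLp.inner_apply]
    refine Finset.sum_congr rfl fun j _ => ?_
    rw [EuclideanSpace.inner_single_right]
    simp [mul_comm]
  have hpow : √n * (1 / (n : ℝ)) = ((n : ℝ) ^ (3 / 4 : ℝ))⁻¹ * (n : ℝ) ^ (1 / 4 : ℝ) := by
    have hinv : 1 / (n : ℝ) = (n : ℝ) ^ (-1 : ℝ) := by rw [Real.rpow_neg_one, one_div]
    rw [Real.sqrt_eq_rpow, hinv, ← Real.rpow_neg hn'.le, ← Real.rpow_add hn',
      ← Real.rpow_add hn']
    norm_num
  rw [← mul_assoc, hpow]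
  simp only [scaledSum, hu, Finset.mul_sum, Finset.sum_mul]
  rw [Finset.sum_comm]
  refine Finset.sum_congr rfl fun j _ => Finset.sum_congr rfl fun i _ => ?_
  ring

theorem abs_sqrt_mul_average_inner_le {n : ℕ} (hn : n ≠ 0) (c : ℕ → ℝ) (x : ℕ → Param m)
    {u : Param m} {ρ : ℝ} (hu : ‖u‖ ≤ ρ) :
    |√n * ((1 / (n : ℝ)) * ∑ i ∈ Finset.range n, c i * inner ℝ (x i) u)| ≤
      (∑ j, |scaledSum n c x j|) * ((n : ℝ) ^ (1 / 4 : ℝ) * ρ) := by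
  rw [sqrt_mul_average_inner_eq hn, Finset.sum_mul]
  refine (Finset.abs_sum_le_sum_abs _ _).trans (Finset.sum_le_sum fun j _ => ?_)
  have h0 : (0 : ℝ) ≤ (n : ℝ) ^ (1 / 4 : ℝ) := by positivity
  rw [abs_mul, abs_mul, abs_of_nonneg h0]
  have : |u j| ≤ ρ := (PiLp.norm_apply_le u j).trans hu
  gcongr

/-- A linear expansion of the summands with quadratic remainder passes to `√n`-scaled averages. -/
theorem abs_sqrt_mul_average_sub_le {n : ℕ} (hn : n ≠ 0) {a b c c₀ c₁ g : ℕ → ℝ}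
    {x : ℕ → Param m} {u b₀ b₁ : Param m} {ρ C : ℝ} (hu : ‖u‖ ≤ ρ) (hb₀ : ‖b₀‖ ≤ ρ)
    (hb₁ : ‖b₁‖ ≤ ρ)
    (h : ∀ i, |a i - b i - (c i * inner ℝ (x i) u + c₀ i * inner ℝ (x i) b₀ +
      c₁ i * inner ℝ (x i) b₁)| ≤ C * ρ ^ 2 * g i) :
    |√n * ((1 / (n : ℝ)) * ∑ i ∈ Finset.range n, a i -
        (1 / (n : ℝ)) * ∑ i ∈ Finset.range n, b i)| ≤
      ((∑ j, |scaledSum n c x j|) + (∑ j, |scaledSum n c₀ x j|) +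
        ∑ j, |scaledSum n c₁ x j|) * ((n : ℝ) ^ (1 / 4 : ℝ) * ρ) +
      C * ((n : ℝ) ^ (1 / 4 : ℝ) * ρ) ^ 2 * ((1 / (n : ℝ)) * ∑ i ∈ Finset.range n, g i) := by
  have hn' : (0 : ℝ) < n := by exact_mod_cast Nat.pos_of_ne_zero hn
  -- Turns √n ρ² into (n^{1/4} ρ)²; this is where the rate n^{-1/4} is exactly what the quadratic
  -- remainder requires.
  have hsq : √n = ((n : ℝ) ^ (1 / 4 : ℝ)) ^ 2 := by
    rw [Real.sqrt_eq_rpow, ← Real.rpow_natCast, ← Real.rpow_mul hn'.le]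
    norm_num
  have hL := (abs_sqrt_mul_average_inner_le hn c x hu)
  have hL₀ := (abs_sqrt_mul_average_inner_le hn c₀ x hb₀)
  have hL₁ := (abs_sqrt_mul_average_inner_le hn c₁ x hb₁)
  have hR := abs_average_sub_le (n := n) (a := fun i => a i - b i)
    (b := fun i => c i * inner ℝ (x i) u + c₀ i * inner ℝ (x i) b₀ + c₁ i * inner ℝ (x i) b₁) h
  simp only [Finset.sum_sub_distrib, Finset.sum_add_distrib, ← Finset.mul_sum] at hR
  have hR' := mul_le_mul_of_nonneg_left hR (Real.sqrt_nonneg n)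
  rw [← abs_of_nonneg (Real.sqrt_nonneg n), ← abs_mul, abs_of_nonneg (Real.sqrt_nonneg n)] at hR'
  have hC : √n * (1 / (n : ℝ) * (C * ρ ^ 2 * ∑ i ∈ Finset.range n, g i)) =
      C * ((n : ℝ) ^ (1 / 4 : ℝ) * ρ) ^ 2 * ((1 / (n : ℝ)) * ∑ i ∈ Finset.range n, g i) := by
    rw [hsq]; ring
  rw [hC] at hR'
  have hsum := (abs_add_le _ _).trans (add_le_add hR' ((abs_add_three _ _ _).trans
    (add_le_add (add_le_add hL hL₀) hL₁)))
  refine le_trans (le_of_eq ?_) (hsum.trans (le_of_eq ?_))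
  · congr 1
    ring
  · ring

/-- Splits the estimation error into the central limit term at the limiting parameters and the
effect of estimating them. For n = 0 both sides are 0. -/
theorem inv_sqrt_mul_sum_sub_add (n : ℕ) (a : ℕ → ℝ) (d δ : ℝ) :
    (√n)⁻¹ * (∑ i ∈ Finset.range n, a i - n * δ) +
      √n * (d - (1 / (n : ℝ)) * ∑ i ∈ Finset.range n, a i) = √n * (d - δ) := by
  rcases Nat.eq_zero_or_pos n with rfl | hn
  · simp
  have hn' : (n : ℝ) ≠ 0 := by exact_mod_cast hn.ne'
  have hs : (√n)⁻¹ = √n * (1 / (n : ℝ)) := by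
    rw [mul_one_div, Real.sqrt_div_self', one_div]
  rw [hs]
  field_simp
  ring

end Linearization

/-! ### Negligible nuisance estimation and asymptotic normality -/

section Normality

variable {Ω : Type*} [MeasurableSpace Ω] {P : Measure Ω} [IsProbabilityMeasure P] {m : ℕ}
  {𝒳 : Type*} [MeasurableSpace 𝒳] {Q : Measure (Indiv 𝒳)}
  {t₁ t₂ : 𝒳 → ℝ} {Φ : 𝒳 → Param m} {W : ℕ → Ω → Indiv 𝒳} {γhat β₀hat β₁hat : ℕ → Ω → Param m}
  {γ β₀ β₁ : Param m}

/-- Each coordinate is a sum of centred terms that the envelope makes square integrable, hence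
o_P(n^{3/4}). -/
theorem tendstoInMeasure_scaledSum (hWmeas : ∀ i, Measurable (W i))
    (hWindep : iIndepFun W P) (hWlaw : ∀ i, P.map (W i) = Q) (hΦ : Measurable Φ)
    {c : Bool × 𝒳 × ℝ → ℝ} (hc : Measurable c) {r C : ℝ}
    (henv : MemLp (fun w => envelope t₁ t₂ Φ γ r (obs w)) 2 Q)
    (hbound : ∀ z, |c z| * (1 + ‖Φ z.2.1‖) ≤ C * envelope t₁ t₂ Φ γ r z)
    (h0 : ∀ v, ∫ w, c (obs w) * inner ℝ (Φ (covar w)) v ∂Q = 0) :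
    TendstoInMeasure P (fun n ω => scaledSum n (fun i => c (obs (W i ω)))
      (fun i => Φ (covar (W i ω)))) atTop (fun _ => 0) := by
  refine tendstoInMeasure_pi fun j => ?_
  have hm : Measurable fun w : Indiv 𝒳 =>
      c (obs w) * inner ℝ (Φ (covar w)) (EuclideanSpace.single j 1) :=
    (hc.comp measurable_obs).mul (measurable_inner_covar hΦ _)
  have hle : ∀ w : Indiv 𝒳, |c (obs w) * inner ℝ (Φ (covar w)) (EuclideanSpace.single j 1)| ≤
      C * envelope t₁ t₂ Φ γ r (obs w) := fun w => by
    refine le_trans ?_ (hbound (obs w))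
    rw [abs_mul]
    refine mul_le_mul_of_nonneg_left ?_ (abs_nonneg _)
    have := abs_inner_le_one_add (Φ (covar w)) (EuclideanSpace.single j (1 : ℝ))
    rw [PiLp.norm_single, norm_one, one_mul] at this
    exact this
  have h := tendstoInMeasure_centred_sum hWmeas hWindep hWlaw hm
    (memLp_of_le_envelope hm henv hle) (h0 _)
  exact h

variable [IsProbabilityMeasure Q] [StandardBorelSpace 𝒳]

/-- Estimating the nuisance parameters does not change the relative error estimator to first
order. -/
theorem tendstoInMeasure_sqrt_mul_deltaHat_sub (hWmeas : ∀ i, Measurable (W i))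
    (hWindep : iIndepFun W P) (hWlaw : ∀ i, P.map (W i) = Q) (hign : StronglyIgnorable Q)
    (ht₁ : Measurable t₁) (ht₂ : Measurable t₂) (hΦ : Measurable Φ)
    (hγmeas : ∀ n, Measurable (γhat n)) (hβ₀meas : ∀ n, Measurable (β₀hat n))
    (hβ₁meas : ∀ n, Measurable (β₁hat n))
    (hγ : FasterThanQuarter P γhat γ) (hβ₀ : FasterThanQuarter P β₀hat β₀)
    (hβ₁ : FasterThanQuarter P β₁hat β₁)
    (hps : propensity Q =ᵐ[Q] fun w => psModel Φ γ (covar w))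
    (hwls : IsWLSStationary Q t₁ t₂ Φ γ β₀ β₁) (hmom : MomentConditions Q t₁ t₂ Φ γ) :
    TendstoInMeasure P (fun (n : ℕ) ω => √n *
      (deltaHat t₁ t₂ Φ (γhat n ω) (β₀hat n ω) (β₁hat n ω) n (fun i => W i ω) -
        deltaHat t₁ t₂ Φ γ β₀ β₁ n (fun i => W i ω))) atTop (fun _ => 0) := by
  obtain ⟨r, hr, hint⟩ := hmom.weighted
  have henv := memLp_envelope ht₁ ht₂ hΦ hint
  obtain ⟨hpsm, hor₀m, hor₁m, henvm⟩ := measurable_coefs ht₁ ht₂ hΦ γ β₀ β₁ r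
  obtain ⟨C, hC, hexp⟩ := exists_phiModel_expansion t₁ t₂ Φ γ β₀ β₁ hr
  obtain ⟨C', hC', hcoef⟩ := exists_coef_bound t₁ t₂ Φ γ β₀ β₁ hr
  have hX := tendstoInMeasure_prodMk
    (tendstoInMeasure_nuisanceError hγmeas hβ₀meas hβ₁meas hγ hβ₀ hβ₁)
    (tendstoInMeasure_prodMk
      (tendstoInMeasure_average hWmeas hWindep hWlaw (henvm.comp measurable_obs)
        (henv.integrable one_le_two))
      (tendstoInMeasure_prodMk
        (tendstoInMeasure_scaledSum hWmeas hWindep hWlaw hΦ hpsm henv (fun z => (hcoef z).1)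
          (integral_psCoef ht₁ ht₂ hΦ hmom hwls))
        (tendstoInMeasure_prodMk
          (tendstoInMeasure_scaledSum hWmeas hWindep hWlaw hΦ hor₀m henv (fun z => (hcoef z).2.1)
            (integral_orCoef₀ hign ht₁ ht₂ hΦ hps hmom))
          (tendstoInMeasure_scaledSum hWmeas hWindep hWlaw hΦ hor₁m henv
            (fun z => (hcoef z).2.2) (integral_orCoef₁ hign ht₁ ht₂ hΦ hps hmom)))))
  refine tendstoInMeasure_of_pathwise hX (fun n =>
    (((measurable_deltaHat hWmeas ht₁ ht₂ hΦ (hγmeas n) (hβ₀meas n) (hβ₁meas n) n).sub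
      (measurable_deltaHat hWmeas ht₁ ht₂ hΦ measurable_const measurable_const measurable_const
        n)).const_mul _).aestronglyMeasurable) fun ω ns hns h => ?_
  have hκ := (continuous_fst.tendsto _).comp h
  have hG := ((continuous_fst.comp continuous_snd).tendsto _).comp h
  have hS := ((continuous_fst.comp (continuous_snd.comp continuous_snd)).tendsto _).comp h
  have hS₀ := ((continuous_fst.comp (continuous_snd.comp
    (continuous_snd.comp continuous_snd))).tendsto _).comp h
  have hS₁ := ((continuous_snd.comp (continuous_snd.comp
    (continuous_snd.comp continuous_snd))).tendsto _).comp h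
  simp only [Function.comp_def] at hκ hG hS hS₀ hS₁
  have hl1 : ∀ {T : ℕ → Fin m → ℝ}, Tendsto T atTop (𝓝 0) →
      Tendsto (fun k => ∑ j, |T k j|) atTop (𝓝 0) := fun {T} hT => by
    have := tendsto_finsetSum (Finset.univ : Finset (Fin m)) fun j _ =>
      ((continuous_apply j).tendsto _ |>.comp hT).abs
    simpa using this
  set ρ : ℕ → ℝ := fun k => nuisanceError γ β₀ β₁ (γhat (ns k) ω) (β₀hat (ns k) ω)
    (β₁hat (ns k) ω) with hρdef
  have hρ0 : ∀ k, 0 ≤ ρ k := fun k => nuisanceError_nonneg _ _ _ _ _ _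
  have hρ := tendsto_zero_of_scaled hns hρ0 hκ
  -- This is the bound of `abs_sqrt_mul_average_sub_le`: every product contains the vanishing scaled
  -- error, and the envelope average stays bounded because it converges.
  have hb := ((((hl1 hS).add (hl1 hS₀)).add (hl1 hS₁)).mul hκ).add (((hκ.pow 2).const_mul C).mul hG)
  simp only [ne_eq, OfNat.ofNat_ne_zero, not_false_eq_true, zero_pow, mul_zero, zero_mul,
    add_zero] at hb
  refine squeeze_zero_norm' ?_ hb
  filter_upwards [hns.eventually_ge_atTop 1,
    hρ.eventually (gt_mem_nhds (show 0 < r / 4 by positivity))] with k hk hk'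
  obtain ⟨hn1, hn2, hn3⟩ := norm_le_nuisanceError γ β₀ β₁ (γhat (ns k) ω) (β₀hat (ns k) ω)
    (β₁hat (ns k) ω)
  refine abs_sqrt_mul_average_sub_le (by omega) hn1 hn2 hn3 fun i => ?_
  have := hexp (obs (W i ω)) _ _ _ _ hn1 hn2 hn3 hk'.le
  simp only [add_sub_cancel] at this
  exact this

/-- Asymptotic normality of the relative error estimator. -/
theorem tendstoInDistribution_sqrt_mul_deltaHat_sub_relErr (hWmeas : ∀ i, Measurable (W i))
    (hWindep : iIndepFun W P) (hWlaw : ∀ i, P.map (W i) = Q) (hign : StronglyIgnorable Q)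
    (ht₁ : Measurable t₁) (ht₂ : Measurable t₂) (hΦ : Measurable Φ)
    (hγmeas : ∀ n, Measurable (γhat n)) (hβ₀meas : ∀ n, Measurable (β₀hat n))
    (hβ₁meas : ∀ n, Measurable (β₁hat n))
    (hγ : FasterThanQuarter P γhat γ) (hβ₀ : FasterThanQuarter P β₀hat β₀)
    (hβ₁ : FasterThanQuarter P β₁hat β₁)
    (hps : propensity Q =ᵐ[Q] fun w => psModel Φ γ (covar w))
    (hwls : IsWLSStationary Q t₁ t₂ Φ γ β₀ β₁) (hmom : MomentConditions Q t₁ t₂ Φ γ) :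
    TendstoInDistribution (fun (n : ℕ) ω => √n *
      (deltaHat t₁ t₂ Φ (γhat n ω) (β₀hat n ω) (β₁hat n ω) n (fun i => W i ω) -
        relErr Q t₁ t₂)) atTop (fun x : ℝ => √(sigmaSq Q t₁ t₂ Φ γ β₀ β₁) * x)
      (fun _ => P) (gaussianReal 0 1) := by
  have hphim : Measurable fun w : Indiv 𝒳 => phiModel t₁ t₂ Φ γ β₀ β₁ (obs w) :=
    (measurable_phiModel ht₁ ht₂ hΦ γ β₀ β₁).comp measurable_obs
  have hphi := hmom.memLp_phiModel ht₁ ht₂ hΦ β₀ β₁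
  have hvar := variance_sample hWmeas hWlaw hphim 0
  have hmean := (integral_sample hWmeas hWlaw hphim 0).trans
    (integral_phiModel hign ht₁ ht₂ hΦ hps hmom β₀ β₁)
  have hlaw : HasLaw (fun x : ℝ => √(sigmaSq Q t₁ t₂ Φ γ β₀ β₁) * x)
      (gaussianReal 0 (variance (fun ω => phiModel t₁ t₂ Φ γ β₀ β₁ (obs (W 0 ω))) P).toNNReal)
      (gaussianReal 0 1) := by
    have h := gaussianReal_const_mul (HasLaw.id (μ := gaussianReal 0 1))
      √(sigmaSq Q t₁ t₂ Φ γ β₀ β₁)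
    convert h using 2
    · simp
    · simp
    · rw [hvar]
      ext
      simp only [mul_one, NNReal.coe_mk]
      rw [sigmaSq, Real.sq_sqrt (variance_nonneg _ _), Real.coe_toNNReal _ (variance_nonneg _ _)]
  have hind : iIndepFun (fun i ω => phiModel t₁ t₂ Φ γ β₀ β₁ (obs (W i ω))) P :=
    hWindep.comp (fun _ w => phiModel t₁ t₂ Φ γ β₀ β₁ (obs w)) fun _ => hphim
  have hclt := tendstoInDistribution_inv_sqrt_mul_sum_sub
    (X := fun i ω => phiModel t₁ t₂ Φ γ β₀ β₁ (obs (W i ω))) hlaw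
    (memLp_sample hWmeas hWlaw hphi 0) hind (identDistrib_sample hWmeas hWlaw hphim)
  have hlin := tendstoInMeasure_sqrt_mul_deltaHat_sub hWmeas hWindep hWlaw hign ht₁ ht₂ hΦ hγmeas
    hβ₀meas hβ₁meas hγ hβ₀ hβ₁ hps hwls hmom
  have hmeas : ∀ n : ℕ, Measurable fun ω => √n *
      (deltaHat t₁ t₂ Φ (γhat n ω) (β₀hat n ω) (β₁hat n ω) n (fun i => W i ω) -
        deltaHat t₁ t₂ Φ γ β₀ β₁ n (fun i => W i ω)) := fun n =>
    ((measurable_deltaHat hWmeas ht₁ ht₂ hΦ (hγmeas n) (hβ₀meas n) (hβ₁meas n) n).sub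
      (measurable_deltaHat hWmeas ht₁ ht₂ hΦ measurable_const measurable_const measurable_const
        n)).const_mul _
  have hadd := hclt.add_of_tendstoInMeasure_const hlin fun n => (hmeas n).aemeasurable
  refine hadd.congr (fun n => ae_of_all _ fun ω => ?_) (ae_of_all _ fun x => add_zero _)
  rw [Pi.add_apply, hmean]
  exact inv_sqrt_mul_sum_sub_add n _ _ _

end Normality

end RelErr

end

/-! ### Consistency and coverage of the confidence interval -/

open RelErr in
theorem proposition2
    {𝒳 : Type*} [MeasurableSpace 𝒳] [StandardBorelSpace 𝒳]
    (Q : Measure (Indiv 𝒳)) [IsProbabilityMeasure Q]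
    {Ω : Type*} [MeasurableSpace Ω] (P : Measure Ω) [IsProbabilityMeasure P]
    -- the test sample: independent draws from the super-population `Q`
    (W : ℕ → Ω → Indiv 𝒳) (hWmeas : ∀ i, Measurable (W i))
    (hWindep : iIndepFun W P) (hWlaw : ∀ i, P.map (W i) = Q)
    (hign : StronglyIgnorable Q)
    -- the two CATE estimators under comparison and the representation
    (t₁ t₂ : 𝒳 → ℝ) (ht₁ : Measurable t₁) (ht₂ : Measurable t₂)
    {m : ℕ} (Φ : 𝒳 → Param m) (hΦ : Measurable Φ)
    -- the nuisance parameter estimators and their probability limits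
    (γhat β₀hat β₁hat : ℕ → Ω → Param m)
    (hγmeas : ∀ n, Measurable (γhat n)) (hβ₀meas : ∀ n, Measurable (β₀hat n))
    (hβ₁meas : ∀ n, Measurable (β₁hat n))
    (γ β₀ β₁ : Param m)
    (hγ : FasterThanQuarter P γhat γ) (hβ₀ : FasterThanQuarter P β₀hat β₀)
    (hβ₁ : FasterThanQuarter P β₁hat β₁)
    -- the propensity score model is correctly specified
    (hps : propensity Q =ᵐ[Q] fun w => psModel Φ γ (covar w))
    (hwls : IsWLSStationary Q t₁ t₂ Φ γ β₀ β₁)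
    (hmom : MomentConditions Q t₁ t₂ Φ γ) :
    TendstoInMeasure P
        (fun (n : ℕ) (ω : Ω) =>
          sigmaHatSq t₁ t₂ Φ (γhat n ω) (β₀hat n ω) (β₁hat n ω) n (fun i => W i ω))
        atTop (fun _ => sigmaSq Q t₁ t₂ Φ γ β₀ β₁) ∧
      (0 < sigmaSq Q t₁ t₂ Φ γ β₀ β₁ →
        ∀ η : ℝ, 0 < η → η < 1 →
          Tendsto
            (fun n : ℕ => P.real {ω : Ω |
              let d := deltaHat t₁ t₂ Φ (γhat n ω) (β₀hat n ω) (β₁hat n ω) n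
                (fun i => W i ω)
              let s := sigmaHatSq t₁ t₂ Φ (γhat n ω) (β₀hat n ω) (β₁hat n ω) n
                (fun i => W i ω)
              relErr Q t₁ t₂ ∈ Set.Icc
                (d - normalQuantile (1 - η / 2) * Real.sqrt (s / n))
                (d + normalQuantile (1 - η / 2) * Real.sqrt (s / n))})
            atTop (𝓝 (1 - η))) := by
  have hcons := tendstoInMeasure_sigmaHatSq hWmeas hWindep hWlaw ht₁ ht₂ hΦ hγmeas hβ₀meas hβ₁meas
    hγ hβ₀ hβ₁ hmom
  refine ⟨hcons, fun hpos η hη0 hη1 => ?_⟩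
  refine (tendsto_studentized_coverage hpos
    (tendstoInDistribution_sqrt_mul_deltaHat_sub_relErr hWmeas hWindep hWlaw hign ht₁ ht₂ hΦ hγmeas
      hβ₀meas hβ₁meas hγ hβ₀ hβ₁ hps hwls hmom) hcons
    (fun n => (measurable_sigmaHatSq hWmeas ht₁ ht₂ hΦ (hγmeas n) (hβ₀meas n) (hβ₁meas n)
      n).aemeasurable) hη0 hη1).congr' ?_
  -- For n > 0, dividing |√n (δ̌ - δ)| ≤ z √σ̂² by √n gives the interval. The case n = 0 must be
  -- dropped, since there the division by √n fails.
  filter_upwards [eventually_gt_atTop 0] with n hn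
  have hn' : (0 : ℝ) < √n := Real.sqrt_pos.2 (by exact_mod_cast hn)
  congr 1
  ext ω
  simp only [Set.mem_ofPred_eq, Set.mem_Icc]
  rw [Real.sqrt_div' _ (Nat.cast_nonneg n), abs_mul, abs_of_pos hn', ← le_div_iff₀' hn',
    mul_div_assoc, abs_le]
  constructor <;> rintro ⟨h1, h2⟩ <;> constructor <;> linarith
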